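/- All graphs are finite and simple. The degree sequence of a graph is the list of its vertex degrees in non-increasing order, and a realization of a degree sequence $d$ is a graph whose degree sequence is $d$. A graph is self-complementary if it is isomorphic to its complement, and a degree sequence is forcibly self-complementary if every realization of it is self-complementary. Call a graph a block if it is isomorphic to the path $P_4$ on four vertices or to one of the two graphs on $\{a_0,a_1,a_2,a_3,b_0,b_1,b_2,b_3\}$ in which $\{a_0,\dots,a_3\}$ is a clique, $\{b_0,\dots,b_3\}$ is an independent set, and the edges between these two sets form either a single cycle of length $8$ or two disjoint cycles of length $4$. The vertex set of each block has a unique partition into a clique and an independent set. An elementary self-complementary pseudo-split graph is a graph isomorphic to one obtained as follows. Take $p \ge 0$ vertex-disjoint blocks $S_1,\dots,S_p$, where $S_i$ has clique $K_i$ and independent set $I_i$, and a further disjoint graph $C$ that is empty, a single vertex, or a five-cycle; for all $1\le i<j\le p$ add all edges between $K_i$ and $K_j\cup I_j$; and add all edges between $C$ and $\bigcup_{i=1}^p K_i$. **Theorem.** A degree sequence is forcibly self-complementary if and only if every realization of it is an elementary self-complementary pseudo-split graph. -/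

import Mathlib

universe u

namespace ForciblySC

/-- A graph is self-complementary if it is isomorphic to its complement. -/
def IsSelfComplementary {V : Type u} (G : SimpleGraph V) : Prop :=
  Nonempty (G ≃g Gᶜ)

/-- The degree sequence of a finite graph: its vertex degrees in non-increasing order. -/
def degreeSequence {V : Type u} [Fintype V] (G : SimpleGraph V) [DecidableRel G.Adj] : List ℕ :=
  ((Finset.univ : Finset V).val.map (fun v => G.degree v)).sort (fun a b => a ≥ b)

/-- `d` is the degree sequence of some finite graph. -/
def IsDegreeSequence (d : List ℕ) : Prop :=
  ∃ (V : Type u) (_ : Fintype V) (G : SimpleGraph V) (_ : DecidableRel G.Adj),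
    degreeSequence G = d

/-- `d` is forcibly self-complementary: all its realizations are self-complementary. -/
def IsForciblySelfComplementary (d : List ℕ) : Prop :=
  ∀ (V : Type u) [Fintype V] (G : SimpleGraph V) [DecidableRel G.Adj],
    degreeSequence G = d → IsSelfComplementary G

/-- The split graph in which `A` is a clique, `B` is an independent set, and `a ∈ A`, `b ∈ B` are
adjacent iff `r a b`. -/
def splitGraph {A B : Type} (r : A → B → Prop) : SimpleGraph (A ⊕ B) where
  Adj x y :=
    match x, y with
    | .inl a, .inl a' => a ≠ a'
    | .inl a, .inr b => r a b
    | .inr b, .inl a => r a b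
    | .inr _, .inr _ => False
  symm := ⟨by
    rintro (a | b) (a' | b') h
    · exact Ne.symm h
    · exact h
    · exact h
    · exact h⟩
  loopless := ⟨by
    rintro (a | b) h
    · exact h rfl
    · exact h⟩

/-- The 8-vertex self-complementary split graph whose edges between the clique and the independent
set form an 8-cycle (addition in `Fin 4` is modulo 4). -/
def eightCycleSplit : SimpleGraph (Fin 4 ⊕ Fin 4) :=
  splitGraph fun a b : Fin 4 => b = a ∨ b = a + 1

/-- The 8-vertex self-complementary split graph whose edges between the clique and the independent
set form two disjoint 4-cycles. -/
def twoFourCyclesSplit : SimpleGraph (Fin 4 ⊕ Fin 4) :=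
  splitGraph fun a b : Fin 4 => a.val / 2 = b.val / 2

/-- The admissible blocks. -/
def IsBlock {W : Type u} (S : SimpleGraph W) : Prop :=
  Nonempty (S ≃g SimpleGraph.pathGraph 4) ∨
    Nonempty (S ≃g eightCycleSplit) ∨ Nonempty (S ≃g twoFourCyclesSplit)

/-- `K` and its complement form a split partition of `S`: a clique and an independent set.
(For an admissible block there is exactly one such `K`.) -/
def IsSplitPartition {W : Type u} (S : SimpleGraph W) (K : Set W) : Prop :=
  S.IsClique K ∧ S.IsIndepSet Kᶜ

/-- The admissible central parts: no vertex, a single vertex, or a five-cycle. -/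
def IsCore {X : Type u} (C : SimpleGraph X) : Prop :=
  IsEmpty X ∨ Nonempty (Unique X) ∨ Nonempty (C ≃g SimpleGraph.cycleGraph 5)

/-- Adjacency in the graph obtained from the disjoint union of the `S i` and `C` by making, for
all `i < j`, the set `K i` complete to the whole of `S j`, and `C` complete to every `K i`. -/
inductive CompositionAdj {p : ℕ} {W : Fin p → Type u} (S : ∀ i, SimpleGraph (W i))
    (K : ∀ i, Set (W i)) {X : Type u} (C : SimpleGraph X) :
    (Σ i, W i) ⊕ X → (Σ i, W i) ⊕ X → Prop
  | block (i : Fin p) (u v : W i) (h : (S i).Adj u v) :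
      CompositionAdj S K C (.inl ⟨i, u⟩) (.inl ⟨i, v⟩)
  | lt (i j : Fin p) (u : W i) (v : W j) (hij : i < j) (hu : u ∈ K i) :
      CompositionAdj S K C (.inl ⟨i, u⟩) (.inl ⟨j, v⟩)
  | gt (i j : Fin p) (u : W i) (v : W j) (hij : i < j) (hu : u ∈ K i) :
      CompositionAdj S K C (.inl ⟨j, v⟩) (.inl ⟨i, u⟩)
  | toCore (i : Fin p) (u : W i) (x : X) (hu : u ∈ K i) :
      CompositionAdj S K C (.inl ⟨i, u⟩) (.inr x)
  | ofCore (i : Fin p) (u : W i) (x : X) (hu : u ∈ K i) :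
      CompositionAdj S K C (.inr x) (.inl ⟨i, u⟩)
  | core (x y : X) (h : C.Adj x y) :
      CompositionAdj S K C (.inr x) (.inr y)

/-- The graph with adjacency `CompositionAdj`. -/
def composition {p : ℕ} {W : Fin p → Type u} (S : ∀ i, SimpleGraph (W i))
    (K : ∀ i, Set (W i)) {X : Type u} (C : SimpleGraph X) :
    SimpleGraph ((Σ i, W i) ⊕ X) where
  Adj := CompositionAdj S K C
  symm := ⟨by
    intro x y h
    cases h with
    | block i u v h => exact .block i v u h.symm
    | lt i j u v hij hu => exact .gt i j u v hij hu
    | gt i j u v hij hu => exact .lt i j u v hij hu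
    | toCore i u x hu => exact .ofCore i u x hu
    | ofCore i u x hu => exact .toCore i u x hu
    | core x y h => exact .core y x h.symm⟩
  loopless := ⟨by
    intro x h
    cases h with
    | block i u v h => exact (S i).irrefl h
    | lt i j u v hij hu => exact lt_irrefl _ hij
    | gt i j u v hij hu => exact lt_irrefl _ hij
    | core x y h => exact C.irrefl h⟩

/-- Elementary self-complementary pseudo-split graphs: up to isomorphism, the compositions of
`p ≥ 0` admissible blocks, each with its split partition `K i`, and an admissible central part. -/
def IsElementarySCPseudoSplit {V : Type u} (G : SimpleGraph V) : Prop :=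
  ∃ (p : ℕ) (W : Fin p → Type u) (S : ∀ i, SimpleGraph (W i)) (K : ∀ i, Set (W i))
    (X : Type u) (C : SimpleGraph X),
    (∀ i, IsBlock (S i) ∧ IsSplitPartition (S i) (K i)) ∧ IsCore C ∧
      Nonempty (G ≃g composition S K C)

end ForciblySC

/-! Sufficiency: the split partition of a block is unique, and each block has an antimorphism (an
isomorphism onto its complement) that interchanges the two sides. Adjacency between different parts
of a composition depends only on whether the endpoint in the earlier block is a clique vertex, so
these antimorphisms and one of the core combine into an antimorphism of the whole.

Necessity goes by induction on the number of vertices, for the property `ForcesSC`. If all degrees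
are equal, self-complementarity and the handshake lemma give order 4k+1 and degree 2k; for k ≥ 2 the
3-colourable graph `apexBipartite k`, which has an independent set of size 4, is a realization that
is not self-complementary, so the graph is a core. Otherwise let A and B be the sets of vertices of
greatest and least degree. Antimorphisms reverse degrees, so in every realization they interchange A
and B, and exactly half of the pairs in A × B are edges. Hence no switch can increase that number,
which forces all edges at B to end in A (`adj_mem_of_mem_min`) and, dually, A to be complete to
everything outside B (`ForcesSC.exists_extremal`).

The bipartite graph between A and B is then m-regular with sides of size 2m and can be replaced
freely by any other such graph. For m ≥ 3 some replacement has equal rows but distinct columns,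
which no antimorphism allows (`extremal_card_le`); m = 1, 2 give exactly the blocks. The remaining
vertices inherit the hypothesis (`ForcesSC.induce`), and the block is put in front of their
decomposition (`IsLayered.cons`). -/

namespace ForciblySC

/-! ### Elementary graphs are self-complementary -/

/-- An isomorphism from a split graph with its two sides interchanged onto its complement. -/
def splitGraphAntimorphism {A B : Type} (r : A → B → Prop) (e : A ≃ B) (f : B ≃ A)
    (h : ∀ a b, r a b ↔ ¬ r (f b) (e a)) : splitGraph r ≃g (splitGraph r)ᶜ where
  toEquiv := (Equiv.sumCongr e f).trans (Equiv.sumComm B A)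
  map_rel_iff' := by
    rintro (a | b) (a' | b')
    · simp [splitGraph, SimpleGraph.compl_adj]
    · have := h a b'
      simp [splitGraph, SimpleGraph.compl_adj]; tauto
    · have := h a' b
      simp [splitGraph, SimpleGraph.compl_adj]; tauto
    · simp [splitGraph, SimpleGraph.compl_adj]

/-- A split graph satisfying the stated condition has a unique split partition. -/
theorem splitGraph_mem_iff {A B : Type} {r : A → B → Prop}
    (h₁ : ∀ b, ∃ a b', b' ≠ b ∧ ¬ r a b ∧ r a b') (h₂ : ∀ a, ∃ b, r a b)
    {K : Set (A ⊕ B)} (hK : IsSplitPartition (splitGraph r) K) (x : A ⊕ B) :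
    x ∈ K ↔ x.isLeft := by
  have hb : ∀ b : B, Sum.inr b ∉ K := by
    intro b hbK
    -- If b were in K, then neither its non-neighbour a nor b' could be; but a and b' are adjacent,
    -- and the complement of K is independent.
    obtain ⟨a, b', hne, hna, hab⟩ := h₁ b
    have ha : Sum.inl a ∉ K := fun ha => hna (hK.1 ha hbK (by simp))
    have hb' : Sum.inr b' ∉ K := fun hb' => hK.1 hb' hbK (by simpa using hne)
    exact hK.2 ha hb' (by simp) hab
  rcases x with a | b
  · simp only [Sum.isLeft_inl, iff_true]
    by_contra ha
    obtain ⟨b, hab⟩ := h₂ a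
    exact hK.2 ha (hb b) (by simp) hab
  · simpa using hb b

/-- The path on four vertices as a split graph. -/
def pathGraphFourIso :
    SimpleGraph.pathGraph 4 ≃g splitGraph (fun a b : Fin 2 => a = b) where
  toFun := ![.inr 0, .inl 0, .inl 1, .inr 1]
  invFun := Sum.elim ![1, 2] ![0, 3]
  left_inv := by decide
  right_inv := by decide
  map_rel_iff' := by
    intro a b
    rw [SimpleGraph.pathGraph_adj]
    fin_cases a <;> fin_cases b <;> simp [splitGraph]

/-- `S` has an antimorphism that interchanges `K` with its complement. -/
def HasSwap {W : Type u} (S : SimpleGraph W) (K : Set W) : Prop :=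
  ∃ σ : S ≃g Sᶜ, ∀ v, σ v ∈ K ↔ v ∉ K

/-- An isomorphism induces an isomorphism of the complements. -/
def complIso {V W : Type*} {G : SimpleGraph V} {H : SimpleGraph W} (e : G ≃g H) : Gᶜ ≃g Hᶜ where
  toEquiv := e.toEquiv
  map_rel_iff' := by
    intro a b
    simp only [SimpleGraph.compl_adj]
    rw [show H.Adj (e.toEquiv a) (e.toEquiv b) ↔ G.Adj a b from e.map_adj_iff]
    simp

/-- Uniqueness of the split partition identifies K with the left side, which the antimorphism of the
split graph exchanges with the right side. -/
theorem hasSwap_of_iso_splitGraph {W : Type u} {S : SimpleGraph W} {A B : Type}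
    {r : A → B → Prop} (g : S ≃g splitGraph r)
    (h₁ : ∀ b, ∃ a b', b' ≠ b ∧ ¬ r a b ∧ r a b') (h₂ : ∀ a, ∃ b, r a b)
    (e : A ≃ B) (f : B ≃ A) (h : ∀ a b, r a b ↔ ¬ r (f b) (e a))
    {K : Set W} (hK : IsSplitPartition S K) : HasSwap S K := by
  have hK' : IsSplitPartition (splitGraph r) (g.symm ⁻¹' K) := by
    constructor
    · intro x hx y hy hxy
      have := hK.1 hx hy (by simpa using hxy)
      exact g.symm.map_adj_iff.1 this
    · intro x hx y hy hxy hadj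
      exact hK.2 hx hy (by simpa using hxy) (g.symm.map_adj_iff.2 hadj)
  have key := splitGraph_mem_iff h₁ h₂ hK'
  have hmem : ∀ v, v ∈ K ↔ (g v).isLeft := by
    intro v
    have := key (g v)
    simpa using this
  refine ⟨(g.trans (splitGraphAntimorphism r e f h)).trans (complIso g.symm), fun v => ?_⟩
  rw [hmem, hmem]
  have : g (((g.trans (splitGraphAntimorphism r e f h)).trans (complIso g.symm)) v) =
      splitGraphAntimorphism r e f h (g v) := by
    change g (g.symm _) = _
    simp
  rw [this]
  rcases g v with a | b <;> simp [splitGraphAntimorphism]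

/-- Modulo 2 or 4, the cross edges of the path and of the 8-cycle are given by b - a in {0} or {0,
1}; exchanging the sides and shifting by 1 turns this into the complementary set of differences. For
two 4-cycles, a shift by 2 exchanges the halves. -/
theorem IsBlock.hasSwap {W : Type u} {S : SimpleGraph W} (hS : IsBlock S) {K : Set W}
    (hK : IsSplitPartition S K) : HasSwap S K := by
  rcases hS with ⟨⟨g⟩⟩ | ⟨⟨g⟩⟩ | ⟨⟨g⟩⟩
  · exact hasSwap_of_iso_splitGraph (g.trans pathGraphFourIso) (by decide) (by decide)
      (Equiv.refl _) (Equiv.addRight 1) (by decide) hK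
  · exact hasSwap_of_iso_splitGraph g (by decide) (by decide)
      (Equiv.refl _) (Equiv.addRight 1) (by decide) hK
  · exact hasSwap_of_iso_splitGraph g (by decide) (by decide)
      (Equiv.refl _) (Equiv.addRight 2) (by decide) hK

theorem IsSelfComplementary.of_iso {V W : Type*} {G : SimpleGraph V} {H : SimpleGraph W}
    (e : G ≃g H) (h : IsSelfComplementary H) : IsSelfComplementary G := by
  obtain ⟨σ⟩ := h
  exact ⟨(e.trans σ).trans (complIso e.symm)⟩

theorem cycleGraph_five_isSelfComplementary :
    IsSelfComplementary (SimpleGraph.cycleGraph 5) := by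
  -- Doubling modulo 5 sends the differences ±1 to ±2, the edges of the complement; 3 is the inverse
  -- of 2.
  refine ⟨⟨⟨fun x => 2 * x, fun x => 3 * x, by decide, by decide⟩, ?_⟩⟩
  decide

theorem IsCore.isSelfComplementary {X : Type u} {C : SimpleGraph X} (h : IsCore C) :
    IsSelfComplementary C := by
  rcases h with h | ⟨⟨h⟩⟩ | ⟨⟨g⟩⟩
  · exact ⟨⟨Equiv.refl _, fun {a} => h.elim a⟩⟩
  · refine ⟨⟨Equiv.refl _, fun {a b} => ?_⟩⟩
    obtain rfl := Subsingleton.elim a b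
    simp
  · exact cycleGraph_five_isSelfComplementary.of_iso g

section composition

variable {p : ℕ} {W : Fin p → Type u} (S : ∀ i, SimpleGraph (W i))
  (K : ∀ i, Set (W i)) {X : Type u} (C : SimpleGraph X)

theorem composition_adj_same (i : Fin p) (u v : W i) :
    (composition S K C).Adj (.inl ⟨i, u⟩) (.inl ⟨i, v⟩) ↔ (S i).Adj u v := by
  constructor
  · rintro (⟨_, _, _, h⟩ | ⟨_, _, _, _, h, _⟩ | ⟨_, _, _, _, h, _⟩)
    · exact h
    · exact absurd h (lt_irrefl _)
    · exact absurd h (lt_irrefl _)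
  · exact fun h => .block i u v h

theorem composition_adj_lt {i j : Fin p} (hij : i < j) (u : W i) (v : W j) :
    (composition S K C).Adj (.inl ⟨i, u⟩) (.inl ⟨j, v⟩) ↔ u ∈ K i := by
  constructor
  · rintro (⟨_, _, _, h⟩ | ⟨_, _, _, _, h, h'⟩ | ⟨_, _, _, _, h, _⟩)
    · exact absurd hij (lt_irrefl _)
    · exact h'
    · exact absurd h hij.not_gt
  · exact fun h => .lt i j u v hij h

theorem composition_adj_gt {i j : Fin p} (hij : i < j) (u : W i) (v : W j) :
    (composition S K C).Adj (.inl ⟨j, v⟩) (.inl ⟨i, u⟩) ↔ u ∈ K i := by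
  rw [SimpleGraph.adj_comm, composition_adj_lt _ _ _ hij]

theorem composition_adj_inl_inr (i : Fin p) (u : W i) (x : X) :
    (composition S K C).Adj (.inl ⟨i, u⟩) (.inr x) ↔ u ∈ K i := by
  constructor
  · rintro (_ | _ | _ | ⟨_, _, _, h⟩)
    exact h
  · exact fun h => .toCore i u x h

theorem composition_adj_inr_inl (i : Fin p) (u : W i) (x : X) :
    (composition S K C).Adj (.inr x) (.inl ⟨i, u⟩) ↔ u ∈ K i := by
  rw [SimpleGraph.adj_comm, composition_adj_inl_inr]

theorem composition_adj_inr_inr (x y : X) :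
    (composition S K C).Adj (.inr x) (.inr y) ↔ C.Adj x y := by
  constructor
  · rintro (_ | _ | _ | _ | _ | ⟨_, _, h⟩)
    exact h
  · exact fun h => .core x y h

/-- Antimorphisms of the parts can be applied separately: swapping each K with its complement
negates every adjacency between different parts. -/
theorem composition_isSelfComplementary (hS : ∀ i, HasSwap (S i) (K i))
    (hC : IsSelfComplementary C) : IsSelfComplementary (composition S K C) := by
  choose σ hσ using hS
  obtain ⟨τ⟩ := hC
  refine ⟨⟨Equiv.sumCongr (Equiv.sigmaCongrRight fun i => (σ i).toEquiv) τ.toEquiv, ?_⟩⟩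
  have hblock : ∀ (i j : Fin p) (u : W i) (v : W j),
      (composition S K C)ᶜ.Adj (.inl ⟨i, σ i u⟩) (.inl ⟨j, σ j v⟩) ↔
        (composition S K C).Adj (.inl ⟨i, u⟩) (.inl ⟨j, v⟩) := by
    intro i j u v
    rcases lt_trichotomy i j with h | rfl | h
    · rw [SimpleGraph.compl_adj, composition_adj_lt _ _ _ h, composition_adj_lt _ _ _ h, hσ]
      simp [h.ne]
    · rw [SimpleGraph.compl_adj, composition_adj_same, composition_adj_same,
        ← (σ i).map_adj_iff (v := u), SimpleGraph.compl_adj]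
      simp
    · rw [SimpleGraph.compl_adj, composition_adj_gt _ _ _ h, composition_adj_gt _ _ _ h, hσ]
      simp [h.ne']
  rintro (⟨i, u⟩ | x) (⟨j, v⟩ | y)
  · exact hblock i j u v
  · change (composition S K C)ᶜ.Adj (.inl ⟨i, σ i u⟩) (.inr (τ y)) ↔ _
    rw [SimpleGraph.compl_adj, composition_adj_inl_inr, composition_adj_inl_inr, hσ]
    simp
  · change (composition S K C)ᶜ.Adj (.inr (τ x)) (.inl ⟨j, σ j v⟩) ↔ _
    rw [SimpleGraph.compl_adj, composition_adj_inr_inl, composition_adj_inr_inl, hσ]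
    simp
  · change (composition S K C)ᶜ.Adj (.inr (τ x)) (.inr (τ y)) ↔ _
    rw [SimpleGraph.compl_adj, composition_adj_inr_inr, composition_adj_inr_inr,
      ← τ.map_adj_iff (v := x), SimpleGraph.compl_adj]
    simp

end composition

theorem IsElementarySCPseudoSplit.isSelfComplementary {V : Type u} {G : SimpleGraph V}
    (h : IsElementarySCPseudoSplit G) : IsSelfComplementary G := by
  obtain ⟨p, W, S, K, X, C, hS, hC, ⟨e⟩⟩ := h
  exact (composition_isSelfComplementary S K C (fun i => (hS i).1.hasSwap (hS i).2)
    hC.isSelfComplementary).of_iso e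

/-! ### Layered graphs -/

/-- `G` decomposes, along a level function `f`, into blocks (the levels below `p`) and a core
(level `p`), where `K` is the union of the clique sides of the blocks. -/
def IsLayered {V : Type u} (G : SimpleGraph V) : Prop :=
  ∃ (p : ℕ) (f : V → ℕ) (K : Set V), (∀ v, f v ≤ p) ∧
    (∀ i < p, IsBlock (G.induce {v | f v = i}) ∧
      IsSplitPartition (G.induce {v | f v = i}) {v | v.1 ∈ K}) ∧
    IsCore (G.induce {v | f v = p}) ∧ ∀ u v, f u < f v → (G.Adj u v ↔ u ∈ K)

theorem IsLayered.isElementary {V : Type u} {G : SimpleGraph V} (h : IsLayered G) :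
    IsElementarySCPseudoSplit G := by
  obtain ⟨p, f, K, hf, hblock, hcore, hadj⟩ := h
  refine ⟨p, fun i => {v | f v = i.1}, fun i => G.induce _, fun i => {v | v.1 ∈ K},
    {v | f v = p}, G.induce _, fun i => hblock i i.2, hcore, ?_⟩
  let g : (Σ i : Fin p, {v | f v = i.1}) ⊕ {v | f v = p} → V :=
    Sum.elim (fun x => x.2.1) (fun x => x.1)
  have hg : Function.Bijective g := by
    constructor
    · rintro (⟨i, u, hu⟩ | ⟨x, hx⟩) (⟨j, v, hv⟩ | ⟨y, hy⟩) h <;>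
        simp only [g, Sum.elim_inl, Sum.elim_inr] at h <;> subst h
      · obtain rfl : i = j := Fin.ext (by simp at hu hv; omega)
        rfl
      · simp at hu hy; have := i.2; omega
      · simp at hx hv; have := j.2; omega
      · rfl
    · intro v
      rcases (hf v).lt_or_eq with h | h
      · exact ⟨.inl ⟨⟨f v, h⟩, v, rfl⟩, rfl⟩
      · exact ⟨.inr ⟨v, h⟩, rfl⟩
  refine ⟨SimpleGraph.Iso.symm ⟨Equiv.ofBijective g hg, ?_⟩⟩
  rintro (⟨i, u, hu⟩ | ⟨x, hx⟩) (⟨j, v, hv⟩ | ⟨y, hy⟩)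
  · rcases lt_trichotomy i j with h | rfl | h
    · rw [composition_adj_lt _ _ _ h]
      exact hadj _ _ (by simp at hu hv; simpa [g, hu, hv] using h)
    · rw [composition_adj_same]
      rfl
    · rw [SimpleGraph.adj_comm, composition_adj_gt _ _ _ h]
      exact hadj _ _ (by simp at hu hv; simpa [g, hu, hv] using h)
  · rw [composition_adj_inl_inr]
    exact hadj _ _ (by simp at hu hy; simp [g, hu, hy])
  · rw [SimpleGraph.adj_comm, composition_adj_inr_inl]
    exact hadj _ _ (by simp at hx hv; simp [g, hx, hv])
  · rw [composition_adj_inr_inr]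
    rfl

open Finset
open scoped Classical

/-! ### Degrees and realizations -/

/-- The degree of `v`, with classical decidability. -/
noncomputable def deg {V : Type u} [Fintype V] (G : SimpleGraph V) (v : V) : ℕ :=
  #{w | G.Adj v w}

/-- Every graph on the same vertex set with the same degrees is self-complementary. -/
def ForcesSC {V : Type u} [Fintype V] (G : SimpleGraph V) : Prop :=
  ∀ H : SimpleGraph V, (∀ v, deg H v = deg G v) → IsSelfComplementary H

variable {V : Type u} [Fintype V]

theorem deg_eq_degree (G : SimpleGraph V) [DecidableRel G.Adj] (v : V) : deg G v = G.degree v := by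
  rw [deg, ← SimpleGraph.card_neighborFinset_eq_degree]
  congr 1
  ext w
  simp

/-- Fixing the vertex set and each vertex's degree gives a form of the hypothesis that passes to
induced subgraphs and can be tested by switches. -/
theorem IsForciblySelfComplementary.forcesSC {d : List ℕ}
    (hd : IsForciblySelfComplementary.{u} d) {G : SimpleGraph V} [DecidableRel G.Adj]
    (hG : degreeSequence G = d) : ForcesSC G := by
  intro H hH
  refine hd V H ?_
  rw [← hG, degreeSequence, degreeSequence]
  congr 2
  funext v
  rw [← deg_eq_degree, ← deg_eq_degree, hH]

theorem deg_antimorphism {H : SimpleGraph V} (σ : H ≃g Hᶜ) (v : V) :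
    deg H (σ v) + deg H v + 1 = Fintype.card V := by
  have h1 : deg H v = #{w | w ≠ σ v ∧ ¬ H.Adj (σ v) w} := by
    rw [deg, ← card_map σ.toEquiv.toEmbedding]
    congr 1
    ext w
    simp only [mem_map_equiv, mem_filter, mem_univ, true_and]
    rw [← σ.map_adj_iff, SimpleGraph.compl_adj]
    have : σ (σ.toEquiv.symm w) = w := σ.toEquiv.apply_symm_apply w
    rw [this, ne_comm]
  have h2 : #{w | ¬ H.Adj (σ v) w} = #{w | w ≠ σ v ∧ ¬ H.Adj (σ v) w} + 1 := by
    rw [← card_insert_of_notMem (a := σ v) (by simp)]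
    congr 1
    ext w
    by_cases hw : w = σ v <;> simp [hw]
  have h3 := card_filter_add_card_filter_not (s := (univ : Finset V)) (fun w => H.Adj (σ v) w)
  rw [card_univ] at h3
  rw [h1, ← h3, h2, deg]
  omega

/-- The degree of `v` splits along any set of vertices. -/
theorem deg_eq_add (G : SimpleGraph V) (S : Finset V) (v : V) :
    deg G v = #{w ∈ S | G.Adj v w} + #{w ∈ Sᶜ | G.Adj v w} := by
  rw [← card_union_of_disjoint, ← filter_union, union_compl, deg]
  exact disjoint_filter_filter disjoint_compl_right

/-! ### Switches -/

/-- Replace the edges `pq` and `rs` by `qr` and `sp`. -/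
def switch {V : Type u} (G : SimpleGraph V) (p q r s : V) : SimpleGraph V :=
  SimpleGraph.fromRel fun x y =>
    (G.Adj x y ∧ s(x, y) ≠ s(p, q) ∧ s(x, y) ≠ s(r, s)) ∨ s(x, y) = s(q, r) ∨ s(x, y) = s(s, p)

theorem switch_adj {V : Type u} {G : SimpleGraph V} {p q r s : V} (hqr : q ≠ r) (hsp : s ≠ p) {x y : V} :
    (switch G p q r s).Adj x y ↔
      (G.Adj x y ∧ s(x, y) ≠ s(p, q) ∧ s(x, y) ≠ s(r, s)) ∨ s(x, y) = s(q, r) ∨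
        s(x, y) = s(s, p) := by
  rw [switch, SimpleGraph.fromRel_adj, Sym2.eq_swap (a := y), G.adj_comm y x, or_self]
  refine and_iff_right_of_imp ?_
  rintro (h | h | h) rfl
  · exact G.irrefl h.1
  · simp at h; grind
  · simp at h; grind

theorem deg_switch {G : SimpleGraph V} {p q r s : V} (hpr : p ≠ r) (hqs : q ≠ s) (hqr : q ≠ r)
    (hsp : s ≠ p) (h1 : G.Adj p q) (h2 : G.Adj r s) (h3 : ¬ G.Adj q r) (h4 : ¬ G.Adj s p) (v : V) :
    deg (switch G p q r s) v = deg G v := by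
  have key : ∀ a b c : V, G.Adj a b → ¬ G.Adj a c →
      (∀ w, (switch G p q r s).Adj a w ↔ (G.Adj a w ∧ w ≠ b) ∨ w = c) →
      deg (switch G p q r s) a = deg G a := by
    intro a b c hb hc h
    have : ({w | (switch G p q r s).Adj a w} : Finset V) =
        insert c (({w | G.Adj a w} : Finset V).erase b) := by
      ext w
      simp only [mem_filter, mem_univ, true_and, h, mem_insert, mem_erase]
      tauto
    rw [deg, this, card_insert_of_notMem (by simp [hc]),
      card_erase_of_mem (by simpa using hb), deg]
    have : 0 < #{w | G.Adj a w} := card_pos.2 ⟨b, by simpa using hb⟩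
    omega
  have e1 := h1.ne
  have e2 := h2.ne
  by_cases hvp : v = p
  · subst hvp
    refine key _ q s h1 (fun h => h4 h.symm) fun w => ?_
    rw [switch_adj hqr hsp]; simp only [Sym2.eq_iff, ne_eq]; grind
  by_cases hvq : v = q
  · subst hvq
    refine key _ p r h1.symm h3 fun w => ?_
    rw [switch_adj hqr hsp]; simp only [Sym2.eq_iff, ne_eq]; grind
  by_cases hvr : v = r
  · subst hvr
    refine key _ s q h2 (fun h => h3 h.symm) fun w => ?_
    rw [switch_adj hqr hsp]; simp only [Sym2.eq_iff, ne_eq]; grind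
  by_cases hvs : v = s
  · subst hvs
    refine key _ r p h2.symm h4 fun w => ?_
    rw [switch_adj hqr hsp]; simp only [Sym2.eq_iff, ne_eq]; grind
  · rw [deg, deg]
    congr 1
    ext w
    simp only [mem_filter, mem_univ, true_and]
    rw [switch_adj hqr hsp]; simp only [Sym2.eq_iff, ne_eq]; grind

/-- Some realization joins `u` to vertices of the highest possible degrees. -/
theorem exists_realization_top (G : SimpleGraph V) (u : V) :
    ∃ H : SimpleGraph V, (∀ v, deg H v = deg G v) ∧
      ∀ x w, H.Adj u x → w ≠ u → deg H x < deg H w → H.Adj u w := by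
  -- Extremal choice: maximize the sum of the degrees of the neighbours of `u`.
  obtain ⟨H, hH, hmax⟩ := Set.exists_max_image {H : SimpleGraph V | ∀ v, deg H v = deg G v}
    (fun H => ∑ v with H.Adj u v, deg G v) (Set.toFinite _) ⟨G, fun _ => rfl⟩
  refine ⟨H, hH, fun x w hux hwu hlt => ?_⟩
  by_contra huw
  have hxw : x ≠ w := by rintro rfl; exact huw hux
  -- Since `w` has larger degree than `x` and misses the neighbour `u` of `x`, it has a neighbour
  -- `z` that `x` lacks. Switching `ux`, `zw` to `xz`, `wu` then replaces `x` by `w` in the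
  -- neighbourhood of `u`.
  obtain ⟨z, hwz, hxz, hzx⟩ : ∃ z, H.Adj w z ∧ ¬ H.Adj x z ∧ z ≠ x := by
    by_contra! hcon
    have hsub : ({z | H.Adj w z} : Finset V).erase x ⊆ ({z | H.Adj x z} : Finset V).erase u := by
      intro z hz
      simp only [mem_erase, mem_filter, mem_univ, true_and] at hz ⊢
      refine ⟨?_, ?_⟩
      · rintro rfl; exact huw hz.2.symm
      · by_contra h; exact hz.1 (hcon z hz.2 h)
    have h1 := card_le_card hsub
    rw [card_erase_of_mem (a := u) (by simpa using hux.symm)] at h1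
    have h2 := pred_card_le_card_erase (s := ({z | H.Adj w z} : Finset V)) (a := x)
    have h3 : 0 < #{z | H.Adj x z} := card_pos.2 ⟨u, by simpa using hux.symm⟩
    rw [deg, deg] at hlt
    omega
  have hzu : z ≠ u := by rintro rfl; exact huw hwz.symm
  have hdeg : ∀ v, deg (switch H u x z w) v = deg G v := fun v =>
    (deg_switch hzu.symm hxw hzx.symm hwu hux hwz.symm hxz (fun h => huw h.symm) v).trans (hH v)
  have hle := hmax _ hdeg
  have hset : ({v | (switch H u x z w).Adj u v} : Finset V) =
      insert w (({v | H.Adj u v} : Finset V).erase x) := by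
    ext v
    have := hux.ne
    simp only [mem_filter, mem_univ, true_and, mem_insert, mem_erase]
    rw [switch_adj hzx.symm hwu]; simp only [Sym2.eq_iff, ne_eq]; grind
  have hxmem : x ∈ ({v | H.Adj u v} : Finset V) := by simpa using hux
  rw [hset, sum_insert (by simp [huw]), ← sum_erase_add _ _ hxmem] at hle
  rw [hH, hH] at hlt
  omega

/-! ### The vertices of extremal degree -/

/-- The antimorphism `σ` interchanges the sets `A` and `B`. -/
def Swaps {V : Type u} {H : SimpleGraph V} (σ : H ≃g Hᶜ) (A B : Finset V) : Prop :=
  (∀ v, σ v ∈ B ↔ v ∈ A) ∧ ∀ v, σ v ∈ A ↔ v ∈ B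

theorem antimorphism_adj {V : Type u} {H : SimpleGraph V} (σ : H ≃g Hᶜ) {x y : V} (h : x ≠ y) :
    H.Adj (σ x) (σ y) ↔ ¬ H.Adj x y := by
  rw [← σ.map_adj_iff (v := x), SimpleGraph.compl_adj]
  simp [h]

theorem Swaps.card_eq {V : Type u} {H : SimpleGraph V} {σ : H ≃g Hᶜ} {A B : Finset V}
    (h : Swaps σ A B) : #A = #B := by
  refine card_bij (fun v _ => σ v) (fun v hv => (h.1 v).2 hv) (fun v _ w _ e => σ.injective e) ?_
  intro w hw
  obtain ⟨v, rfl⟩ := σ.surjective w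
  exact ⟨v, (h.1 v).1 hw, rfl⟩

/-- The number of edges between `A` and `B`. -/
noncomputable def crossing {V : Type u} (H : SimpleGraph V) (A B : Finset V) : ℕ :=
  #{x ∈ A ×ˢ B | H.Adj x.1 x.2}

theorem crossing_eq_sum {V : Type u} (H : SimpleGraph V) (A B : Finset V) :
    crossing H A B = ∑ b ∈ B, #{a ∈ A | H.Adj b a} := by
  rw [crossing, card_filter, sum_product_right]
  simp_rw [card_filter, H.adj_comm]

/-- The map (a, b) ↦ (σ b, σ a) is a bijection of A × B onto itself that interchanges edges and
non-edges. -/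
theorem Swaps.two_mul_crossing {V : Type u} {H : SimpleGraph V} {σ : H ≃g Hᶜ} {A B : Finset V}
    (h : Swaps σ A B) (hAB : Disjoint A B) : 2 * crossing H A B = #A * #B := by
  have h1 : crossing H A B = #{x ∈ A ×ˢ B | ¬ H.Adj x.1 x.2} := by
    refine card_bij (fun x _ => (σ x.2, σ x.1)) ?_ ?_ ?_
    · rintro ⟨a, b⟩ hx
      simp only [mem_filter, mem_product] at hx ⊢
      refine ⟨⟨(h.2 b).2 hx.1.2, (h.1 a).2 hx.1.1⟩, ?_⟩
      have hne : b ≠ a := fun e => disjoint_left.1 hAB hx.1.1 (e ▸ hx.1.2)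
      rw [antimorphism_adj σ hne, not_not]
      exact hx.2.symm
    · rintro ⟨a, b⟩ _ ⟨a', b'⟩ _ e
      simp only [Prod.mk.injEq] at e
      rw [σ.injective e.1, σ.injective e.2]
    · rintro ⟨x, y⟩ hx
      obtain ⟨b, rfl⟩ := σ.surjective x
      obtain ⟨a, rfl⟩ := σ.surjective y
      simp only [mem_filter, mem_product] at hx
      have ha := (h.1 a).1 hx.1.2
      have hb := (h.2 b).1 hx.1.1
      refine ⟨(a, b), ?_, rfl⟩
      simp only [mem_filter, mem_product]
      refine ⟨⟨ha, hb⟩, ?_⟩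
      have hne : b ≠ a := fun e => disjoint_left.1 hAB ha (e ▸ hb)
      have := (antimorphism_adj σ hne).not.1 hx.2
      exact (not_not.1 this).symm
  have h2 := card_filter_add_card_filter_not (s := A ×ˢ B) (fun x => H.Adj x.1 x.2)
  rw [card_product] at h2
  rw [two_mul, ← h2]
  exact congrArg₂ _ rfl h1

/-- If the number of edges between `A` and `B` is the same in all realizations, no switch
increases it. -/
theorem no_crossing_switch {G : SimpleGraph V} {A B : Finset V} (hAB : Disjoint A B)
    (hcr : ∀ H : SimpleGraph V, (∀ v, deg H v = deg G v) → 2 * crossing H A B = #A * #B)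
    {H : SimpleGraph V} (hH : ∀ v, deg H v = deg G v) {v y w z : V} (hv : v ∈ A) (hy : y ∈ B)
    (hw : w ∉ B) (hz : z ∉ A) (hvy : ¬ H.Adj v y) (hyz : H.Adj y z) (hvw : H.Adj v w)
    (hwz : w ≠ z) : H.Adj w z := by
  by_contra hwz'
  have hvne : v ≠ y := fun e => disjoint_left.1 hAB hv (e ▸ hy)
  have hvz : v ≠ z := fun e => hz (e ▸ hv)
  have hyw : y ≠ w := fun e => hw (e ▸ hy)
  have hdeg : ∀ x, deg (switch H w v y z) x = deg G x := fun x =>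
    (deg_switch hyw.symm hvz hvne hwz.symm hvw.symm hyz hvy (fun h => hwz' h.symm) x).trans (hH x)
  -- The removed edges `wv` and `yz` are not between `A` and `B`, while the added edge `vy` is.
  have hlt : crossing H A B < crossing (switch H w v y z) A B := by
    refine card_lt_card ⟨?_, fun hsub => ?_⟩
    · rintro ⟨a, b⟩ hab
      simp only [mem_filter, mem_product] at hab ⊢
      refine ⟨hab.1, ?_⟩
      rw [switch_adj hvne hwz.symm]
      refine Or.inl ⟨hab.2, ?_, ?_⟩ <;> simp only [ne_eq, Sym2.eq_iff] <;>
        rintro (⟨rfl, rfl⟩ | ⟨rfl, rfl⟩)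
      · exact disjoint_left.1 hAB hv hab.1.2
      · exact hw hab.1.2
      · exact disjoint_left.1 hAB hab.1.1 hy
      · exact hz hab.1.1
    · have : (v, y) ∈ ({x ∈ A ×ˢ B | H.Adj x.1 x.2} : Finset (V × V)) := by
        apply hsub
        simp only [mem_filter, mem_product]
        refine ⟨⟨hv, hy⟩, ?_⟩
        rw [switch_adj hvne hwz.symm]
        simp
      simp only [mem_filter] at this
      exact hvy this.2
  have := hcr _ hdeg
  have := hcr _ hH
  omega

/-- The vertices of least degree have all their neighbours among those of greatest degree. -/
theorem adj_mem_of_mem_min {G : SimpleGraph V} {A B : Finset V} (hAB : Disjoint A B)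
    (hA : A.Nonempty) {Δ δ : ℕ} (hAdeg : ∀ v ∈ A, deg G v = Δ) (hBdeg : ∀ v ∈ B, deg G v = δ)
    (hlt : ∀ v ∉ B, δ < deg G v)
    (hsw : ∀ H : SimpleGraph V, (∀ v, deg H v = deg G v) → ∃ σ : H ≃g Hᶜ, Swaps σ A B) :
    2 * δ = #A ∧ ∀ y ∈ B, ∀ z, G.Adj y z → z ∈ A := by
  have hcr : ∀ H : SimpleGraph V, (∀ v, deg H v = deg G v) → 2 * crossing H A B = #A * #B := by
    intro H hH
    obtain ⟨σ, hσ⟩ := hsw H hH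
    exact hσ.two_mul_crossing hAB
  obtain ⟨u, hu⟩ := hA
  obtain ⟨H, hH, htop⟩ := exists_realization_top G u
  obtain ⟨σ, hσ⟩ := hsw H hH
  have hcard := hσ.card_eq
  -- `u` has a neighbour of least degree, so it is joined to everything outside `B`
  obtain ⟨x, hxB, hux⟩ : ∃ x ∈ B, H.Adj u x := by
    by_contra! hcon
    -- Write u = σ b with b in B. If `u` missed all of B, the non-edge `ub` would become an edge
    -- from `u` to σ u, which lies in B.
    have h1 : σ u ∈ B := (hσ.1 u).2 hu
    obtain ⟨b, hb⟩ := σ.surjective u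
    have hbB : b ∈ B := (hσ.2 b).1 (hb ▸ hu)
    have hub : u ≠ b := fun e => disjoint_left.1 hAB hu (e ▸ hbB)
    have := (antimorphism_adj σ hub).2 (hcon b hbB)
    rw [hb] at this
    exact hcon _ h1 this.symm
  have huall : ∀ w ∉ B, w ≠ u → H.Adj u w := by
    intro w hw hwu
    refine htop x w hux hwu ?_
    rw [hH, hH, hBdeg x hxB]
    exact hlt w hw
  have hn : δ + Δ + 1 = Fintype.card V := by
    have := deg_antimorphism σ u
    rwa [hH, hH, hAdeg u hu, hBdeg _ ((hσ.1 u).2 hu)] at this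
  have hBc : #B + #Bᶜ = Fintype.card V := by
    rw [card_add_card_compl]
  -- By degree reversal `u` has n - 1 - Δ = δ non-neighbours other than itself, and all of them lie
  -- in B.
  have hnon : #{y ∈ B | ¬ H.Adj u y} = δ := by
    have h1 := deg_eq_add H B u
    have h2 : #{w ∈ Bᶜ | H.Adj u w} + 1 = #Bᶜ := by
      have huB : u ∈ Bᶜ := by simpa using disjoint_left.1 hAB hu
      rw [← card_erase_add_one huB]
      congr 2
      ext w
      simp only [mem_filter, mem_compl, mem_erase]
      constructor
      · rintro ⟨h, h'⟩; exact ⟨h'.ne', h⟩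
      · rintro ⟨h, h'⟩; exact ⟨h', huall w h' h⟩
    have h3 := card_filter_add_card_filter_not (s := B) (fun w => H.Adj u w)
    rw [hH, hAdeg u hu] at h1
    omega
  have hδB : δ < #B := by
    rw [← hnon]
    refine card_lt_card ⟨filter_subset _ _, fun h => ?_⟩
    have := h hxB
    simp only [mem_filter] at this
    exact this.2 hux
  -- a vertex `y ∈ B` missed by a vertex joined to everything outside `B` is joined to `A` only
  have hanti : ∀ v ∈ A, (∀ w ∉ B, w ≠ v → H.Adj v w) → ∀ y ∈ B, ¬ H.Adj v y →
      ∀ z, H.Adj y z → z ∈ A := by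
    intro v hv hvall y hy hvy z hyz
    by_contra hz
    have hzall : ∀ w ∉ B, w ≠ v → w ≠ z → H.Adj w z := fun w hw hwv hwz =>
      no_crossing_switch hAB hcr hH hv hy hw hz hvy hyz (hvall w hw hwv) hwz
    -- If z is in B, its degree δ would be at least |Bᶜ| ≥ |A| = |B| > δ.
    by_cases hzB : z ∈ B
    · have h1 : insert y (Bᶜ.erase v) ⊆ ({w | H.Adj z w} : Finset V) := by
        intro w hw
        simp only [mem_insert, mem_erase, mem_compl] at hw
        simp only [mem_filter, mem_univ, true_and]
        rcases hw with rfl | ⟨hwv, hw⟩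
        · exact hyz.symm
        · exact (hzall w hw hwv (fun e => hw (e ▸ hzB))).symm
      have hvB : v ∈ Bᶜ := by simpa using disjoint_left.1 hAB hv
      have h2 := card_le_card h1
      rw [card_insert_of_notMem (by simp [hy]), card_erase_add_one hvB] at h2
      have h3 : deg H z = δ := (hH z).trans (hBdeg z hzB)
      rw [deg] at h3
      have h4 : #A ≤ #Bᶜ := card_le_card fun a ha => by simpa using disjoint_left.1 hAB ha
      omega
    -- Otherwise z is joined to everything outside B, so σ z is joined to nothing outside A. As z
    -- and σ z both lie outside A ∪ B, these facts conflict on the pair z, σ z, or on y, z when σ z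
    -- = z.
    · have hzall' : ∀ w ∉ B, w ≠ z → H.Adj w z := by
        intro w hw hwz
        by_cases hwv : w = v
        · subst hwv; exact hvall z hzB hwz.symm
        · exact hzall w hw hwv hwz
      have hσB : σ z ∉ B := fun h => hz ((hσ.1 z).1 h)
      have hσA : σ z ∉ A := fun h => hzB ((hσ.2 z).1 h)
      have hmiss : ∀ w ∉ A, w ≠ σ z → ¬ H.Adj w (σ z) := by
        intro w hw hwz
        obtain ⟨w, rfl⟩ := σ.surjective w
        have hne : w ≠ z := fun e => hwz (e ▸ rfl)
        rw [antimorphism_adj σ hne, not_not]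
        exact hzall' w (fun h => hw ((hσ.2 w).2 h)) hne
      by_cases he : σ z = z
      · refine hmiss y (fun h => disjoint_left.1 hAB h hy) ?_ ?_
        · rw [he]; exact hyz.ne
        · rw [he]; exact hyz
      · exact hmiss z hz (Ne.symm he) (hzall' _ hσB he).symm
  -- hence all of `B` is joined to `A` only
  have hBall : ∀ y ∈ B, ∀ z, H.Adj y z → z ∈ A := by
    by_contra! hcon
    obtain ⟨y, hy, z, hyz, hz⟩ := hcon
    -- σ injects the δ vertices of B missed by `u` into A₀, so |A₀| ≥ δ. A vertex y of B with a
    -- neighbour z outside A is joined to z and all of A₀, exceeding its degree δ.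
    set A₀ : Finset V := {v ∈ A | ∀ w ∉ B, w ≠ v → H.Adj v w} with hA₀
    have h1 : #{y ∈ B | ¬ H.Adj u y} ≤ #A₀ := by
      refine card_le_card_of_injOn σ ?_ σ.injective.injOn
      intro b hb
      simp only [coe_filter, Set.mem_ofPred_eq] at hb
      simp only [hA₀, coe_filter, Set.mem_ofPred_eq]
      refine ⟨(hσ.2 b).2 hb.1, fun w hw hwb => ?_⟩
      obtain ⟨w, rfl⟩ := σ.surjective w
      have hne : b ≠ w := fun e => hwb (e ▸ rfl)
      rw [antimorphism_adj σ hne]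
      exact fun h => hw ((hσ.1 w).2 (hanti u hu huall b hb.1 hb.2 w h))
    have h2 : insert z A₀ ⊆ ({w | H.Adj y w} : Finset V) := by
      intro w hw
      simp only [mem_insert] at hw
      simp only [mem_filter, mem_univ, true_and]
      rcases hw with rfl | hw
      · exact hyz
      · simp only [hA₀, mem_filter] at hw
        by_contra h
        exact hz (hanti w hw.1 hw.2 y hy (fun h' => h h'.symm) z hyz)
    have h3 := card_le_card h2
    rw [card_insert_of_notMem (by simp [hA₀, hz])] at h3
    have h4 : deg H y = δ := (hH y).trans (hBdeg y hy)
    rw [deg] at h4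
    omega
  have hle : ∀ F : SimpleGraph V, ∀ y, #{a ∈ A | F.Adj y a} ≤ deg F y := fun F y =>
    card_le_card (filter_subset_filter _ (subset_univ A))
  have hδ : 2 * δ = #A := by
    have h1 := hcr H hH
    have h2 : crossing H A B = #B * δ := by
      rw [crossing_eq_sum, sum_const_nat]
      intro y hy
      rw [← hBdeg y hy, ← hH y, deg]
      congr 1
      ext w
      simp only [mem_filter, mem_univ, true_and, and_iff_right_iff_imp]
      exact hBall y hy w
    rw [h2] at h1
    have : 0 < #B := by omega
    have h3 : #B * (2 * δ) = #B * #A := by linarith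
    exact Nat.eq_of_mul_eq_mul_left this h3
  refine ⟨hδ, fun y hy z hyz => ?_⟩
  have h1 := hcr G fun _ => rfl
  -- The crossing number does not depend on the realization, so in G too the edges into A already
  -- exhaust all degrees in B.
  have h2 : ∑ b ∈ B, #{a ∈ A | G.Adj b a} = ∑ b ∈ B, deg G b := by
    rw [← crossing_eq_sum, sum_congr rfl hBdeg, sum_const, smul_eq_mul]
    rw [← hδ] at h1
    linarith
  have h3 := (sum_eq_sum_iff_of_le fun b _ => hle G b).1 h2 y hy
  have h4 : ({a ∈ A | G.Adj y a} : Finset V) = ({a | G.Adj y a} : Finset V) :=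
    eq_of_subset_of_card_le (filter_subset_filter _ (subset_univ A)) (by rw [h3, deg])
  have h5 : z ∈ ({a | G.Adj y a} : Finset V) := by simpa using hyz
  rw [← h4] at h5
  exact (mem_filter.1 h5).1

/-- If all realizations of a non-regular degree function are self-complementary, then the vertices
of greatest degree form a clique `A`, those of least degree an independent set `B`, `A` is complete
and `B` anticomplete to the remaining vertices, and half of all pairs in `A × B`, at each vertex,
are edges. -/
theorem ForcesSC.exists_extremal {G : SimpleGraph V} (hG : ForcesSC G)
    (hreg : ∃ v w, deg G v ≠ deg G w) :
    ∃ A B : Finset V, ∃ m : ℕ, 0 < m ∧ Disjoint A B ∧ #A = 2 * m ∧ #B = 2 * m ∧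
      (∀ y ∈ B, ∀ z, G.Adj y z → z ∈ A) ∧ (∀ v ∈ A, ∀ w ∉ B, w ≠ v → G.Adj v w) ∧
      (∀ y ∈ B, #{a ∈ A | G.Adj y a} = m) ∧ (∀ v ∈ A, #{b ∈ B | G.Adj v b} = m) ∧
      ∀ H : SimpleGraph V, (∀ v, deg H v = deg G v) → ∃ σ : H ≃g Hᶜ, Swaps σ A B := by
  obtain ⟨v₀, w₀, hne⟩ := hreg
  have : Nonempty V := ⟨v₀⟩
  obtain ⟨a, ha⟩ := Finite.exists_max (deg G)
  obtain ⟨b, hb⟩ := Finite.exists_min (deg G)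
  have hlt : deg G b < deg G a := by
    have := ha v₀; have := ha w₀; have := hb v₀; have := hb w₀
    omega
  set A : Finset V := {v | deg G v = deg G a} with hA
  set B : Finset V := {v | deg G v = deg G b} with hB
  have hAB : Disjoint A B := by
    rw [disjoint_left]
    intro v h1 h2
    simp only [hA, hB, mem_filter, mem_univ, true_and] at h1 h2
    omega
  have hsw : ∀ H : SimpleGraph V, (∀ v, deg H v = deg G v) → ∃ σ : H ≃g Hᶜ, Swaps σ A B := by
    intro H hH
    obtain ⟨σ⟩ := hG H hH
    have h1 : ∀ v, deg G (σ v) + deg G v + 1 = Fintype.card V := by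
      intro v
      have := deg_antimorphism σ v
      rwa [hH, hH] at this
    -- Degree reversal pairs the least degree with the greatest.
    have h2 : deg G b + deg G a + 1 = Fintype.card V := by
      obtain ⟨c, rfl⟩ := σ.surjective b
      have := h1 c
      have := h1 a
      have := ha c
      have := hb (σ a)
      omega
    refine ⟨σ, fun v => ?_, fun v => ?_⟩ <;> have := h1 v <;>
      simp only [hA, hB, mem_filter, mem_univ, true_and] <;> omega
  obtain ⟨h2δ, hadj⟩ := adj_mem_of_mem_min (G := G) (A := A) (B := B) hAB ⟨a, by simp [hA]⟩
    (fun v hv => by simpa [hA] using hv) (fun v hv => by simpa [hB] using hv)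
    (fun v hv => lt_of_le_of_ne (hb v) (fun e => hv (by simp [hB, e]))) hsw
  obtain ⟨σ, hσ⟩ := hsw G fun _ => rfl
  have hcard := hσ.card_eq
  -- This is the image under σ of the statement that B has no edges leaving A.
  have hAall : ∀ v ∈ A, ∀ w ∉ B, w ≠ v → G.Adj v w := by
    intro v hv w hw hwv
    obtain ⟨y, rfl⟩ := σ.surjective v
    obtain ⟨z, rfl⟩ := σ.surjective w
    have hne : y ≠ z := fun e => hwv (e ▸ rfl)
    rw [antimorphism_adj σ hne]
    exact fun h => hw ((hσ.1 z).2 (hadj y ((hσ.2 y).1 hv) z h))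
  have hBdeg : ∀ y ∈ B, #{a ∈ A | G.Adj y a} = deg G b := by
    intro y hy
    have h1 : deg G y = deg G b := by simpa [hB] using hy
    rw [← h1, deg]
    congr 1
    ext w
    simp only [mem_filter, mem_univ, true_and, and_iff_right_iff_imp]
    exact hadj y hy w
  refine ⟨A, B, deg G b, ?_, hAB, h2δ.symm, by omega, hadj, hAall, hBdeg, ?_, hsw⟩
  · have : 0 < #A := card_pos.2 ⟨a, by simp [hA]⟩
    omega
  · intro v hv
    have h1 : #{a ∈ A | G.Adj (σ v) a} = #{b ∈ B | ¬ G.Adj v b} := by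
      symm
      refine card_bij (fun x _ => σ x) ?_ (fun _ _ _ _ e => σ.injective e) ?_
      · intro x hx
        simp only [mem_filter] at hx ⊢
        have hne : v ≠ x := fun e => disjoint_left.1 hAB hv (e ▸ hx.1)
        exact ⟨(hσ.2 x).2 hx.1, (antimorphism_adj σ hne).2 hx.2⟩
      · intro x hx
        obtain ⟨x, rfl⟩ := σ.surjective x
        simp only [mem_filter] at hx
        have hxB := (hσ.2 x).1 hx.1
        have hne : v ≠ x := fun e => disjoint_left.1 hAB hv (e ▸ hxB)
        exact ⟨x, by simpa using ⟨hxB, (antimorphism_adj σ hne).1 hx.2⟩, rfl⟩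
    have h2 := hBdeg (σ v) ((hσ.1 v).2 hv)
    have h3 := card_filter_add_card_filter_not (s := B) (fun w => G.Adj v w)
    omega

/-! ### Replacing the edges between two sets -/

theorem deg_congr {G H : SimpleGraph V} (S : Finset V) {v : V}
    (hS : #{w ∈ S | H.Adj v w} = #{w ∈ S | G.Adj v w})
    (h : ∀ w ∉ S, H.Adj v w ↔ G.Adj v w) : deg H v = deg G v := by
  rw [deg_eq_add H S, deg_eq_add G S, hS]
  congr 2
  exact filter_congr fun w hw => h w (by simpa using hw)

/-- Replace the edges between `A` and `B` by those given by `r`. -/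
def rewire {V : Type u} (G : SimpleGraph V) (A B : Finset V) (r : V → V → Prop) : SimpleGraph V :=
  SimpleGraph.fromRel fun x y =>
    (x ∈ A ∧ y ∈ B ∧ r x y) ∨ (G.Adj x y ∧ ¬ (x ∈ A ∧ y ∈ B) ∧ ¬ (x ∈ B ∧ y ∈ A))

theorem rewire_adj_mem {V : Type u} {G : SimpleGraph V} {A B : Finset V} (hAB : Disjoint A B)
    {r : V → V → Prop} {x y : V} (hx : x ∈ A) (hy : y ∈ B) : (rewire G A B r).Adj x y ↔ r x y := by
  have hxB := disjoint_left.1 hAB hx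
  have hne : x ≠ y := fun e => hxB (e ▸ hy)
  rw [rewire, SimpleGraph.fromRel_adj]
  simp [hx, hy, hxB, hne]

theorem rewire_adj_of_not {V : Type u} {G : SimpleGraph V} {A B : Finset V} {r : V → V → Prop}
    {x y : V} (h : ¬ (x ∈ A ∧ y ∈ B)) (h' : ¬ (x ∈ B ∧ y ∈ A)) :
    (rewire G A B r).Adj x y ↔ G.Adj x y := by
  rw [rewire, SimpleGraph.fromRel_adj, G.adj_comm y x]
  have := fun h : G.Adj x y => h.ne
  tauto

theorem deg_rewire {G : SimpleGraph V} {A B : Finset V} (hAB : Disjoint A B) {r : V → V → Prop}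
    (hA : ∀ a ∈ A, #{b ∈ B | r a b} = #{b ∈ B | G.Adj a b})
    (hB : ∀ b ∈ B, #{a ∈ A | r a b} = #{a ∈ A | G.Adj b a}) (v : V) :
    deg (rewire G A B r) v = deg G v := by
  by_cases hvA : v ∈ A
  · have hvB := disjoint_left.1 hAB hvA
    refine deg_congr B ?_ fun w hw => rewire_adj_of_not (by tauto) (by tauto)
    rw [← hA v hvA]
    congr 1
    exact filter_congr fun w hw => rewire_adj_mem hAB hvA hw
  by_cases hvB : v ∈ B
  · refine deg_congr A ?_ fun w hw => rewire_adj_of_not (by tauto) (by tauto)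
    rw [← hB v hvB]
    congr 1
    refine filter_congr fun w hw => ?_
    rw [SimpleGraph.adj_comm, rewire_adj_mem hAB hw hvB]
  · exact deg_congr ∅ (by simp) fun w hw => rewire_adj_of_not (by tauto) (by tauto)

/-- A relation with constant row and column sums, distinct columns, and coinciding rows. -/
def unbalanced (m : ℕ) [NeZero m] : Fin m ⊕ Fin m → Fin m ⊕ Fin m → Prop
  | .inl i, .inl j => i = j
  | .inl i, .inr j => i ≠ j
  | .inr k, .inl _ => k ≠ 0
  | .inr k, .inr _ => k = 0

theorem card_filter_sum {m : ℕ} (q : Fin m ⊕ Fin m → Prop) (S T : Finset (Fin m))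
    (hS : ∀ j, j ∈ S ↔ q (.inl j)) (hT : ∀ j, j ∈ T ↔ q (.inr j)) : #{j | q j} = #S + #T := by
  rw [← card_disjSum]
  congr 1
  ext (j | j) <;> simp [hS, hT]

theorem card_unbalanced_row (m : ℕ) [NeZero m] (i : Fin m ⊕ Fin m) :
    #{j | unbalanced m i j} = m := by
  have := NeZero.pos m
  rcases i with i | k
  · rw [card_filter_sum _ {i} {i}ᶜ (by simp [unbalanced, eq_comm]) (by simp [unbalanced, eq_comm]),
      card_add_card_compl, Fintype.card_fin]
  · by_cases hk : k = 0
    · rw [card_filter_sum _ ∅ univ (by simp [unbalanced, hk]) (by simp [unbalanced, hk])]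
      simp
    · rw [card_filter_sum _ univ ∅ (by simp [unbalanced, hk]) (by simp [unbalanced, hk])]
      simp

theorem card_unbalanced_column (m : ℕ) [NeZero m] (j : Fin m ⊕ Fin m) :
    #{i | unbalanced m i j} = m := by
  rcases j with j | j
  · rw [card_filter_sum _ {j} {0}ᶜ (by simp [unbalanced]) (by simp [unbalanced]), card_compl,
      Fintype.card_fin, card_singleton, card_singleton]
    have := NeZero.pos m
    omega
  · rw [card_filter_sum _ {j}ᶜ {0} (by simp [unbalanced]) (by simp [unbalanced]), card_compl,
      Fintype.card_fin, card_singleton, card_singleton]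
    have := NeZero.pos m
    omega

/-- Row `inl j` separates column j from the others of its kind, and row `inr 1`, which exists only
for m > 1, separates the two kinds. -/
theorem unbalanced_column_injective {m : ℕ} [NeZero m] (hm : 1 < m) {j j' : Fin m ⊕ Fin m}
    (h : ∀ i, unbalanced m i j ↔ unbalanced m i j') : j = j' := by
  have h1 : (⟨1, hm⟩ : Fin m) ≠ 0 := by simp [Fin.ext_iff]
  rcases j with j | j <;> rcases j' with j' | j'
  · have := h (.inl j)
    simp only [unbalanced, true_iff] at this
    rw [this]
  · have := h (.inr ⟨1, hm⟩)
    simp [unbalanced, h1] at this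
  · have := h (.inr ⟨1, hm⟩)
    simp [unbalanced, h1] at this
  · have := h (.inl j)
    simp only [unbalanced, ne_eq, not_true_eq_false, false_iff, not_not] at this
    rw [this]

/-- In the situation of `ForcesSC.exists_extremal`, at most eight vertices have extremal degree. -/
theorem extremal_card_le {G : SimpleGraph V} {A B : Finset V} {m : ℕ} (hAB : Disjoint A B)
    (hA : #A = 2 * m) (hB : #B = 2 * m) (hBm : ∀ y ∈ B, #{a ∈ A | G.Adj y a} = m)
    (hAm : ∀ v ∈ A, #{b ∈ B | G.Adj v b} = m)
    (hsw : ∀ H : SimpleGraph V, (∀ v, deg H v = deg G v) → ∃ σ : H ≃g Hᶜ, Swaps σ A B) :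
    m ≤ 2 := by
  by_contra! hm
  have : NeZero m := ⟨by omega⟩
  have eA : Fin m ⊕ Fin m ≃ A := Fintype.equivOfCardEq (by simp [hA, two_mul])
  have eB : Fin m ⊕ Fin m ≃ B := Fintype.equivOfCardEq (by simp [hB, two_mul])
  obtain ⟨r, hr⟩ : ∃ r : V → V → Prop, ∀ i j, r (eA i) (eB j) ↔ unbalanced m i j := by
    refine ⟨fun x y => ∃ i j, (eA i : V) = x ∧ (eB j : V) = y ∧ unbalanced m i j, fun i j => ?_⟩
    constructor
    · rintro ⟨i', j', h1, h2, h⟩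
      rwa [eA.injective (Subtype.ext h1), eB.injective (Subtype.ext h2)] at h
    · exact fun h => ⟨i, j, rfl, rfl, h⟩
  have hrow : ∀ a ∈ A, #{b ∈ B | r a b} = m := by
    intro a ha
    obtain ⟨i, hi⟩ := eA.surjective ⟨a, ha⟩
    obtain rfl : (eA i : V) = a := congrArg Subtype.val hi
    refine Eq.trans (Eq.symm ?_) (card_unbalanced_row m i)
    refine card_bij (fun j _ => (eB j : V)) ?_ (fun _ _ _ _ e => eB.injective (Subtype.ext e)) ?_
    · intro j hj
      simp only [mem_filter, mem_univ, true_and] at hj ⊢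
      exact ⟨(eB j).2, (hr i j).2 hj⟩
    · intro b hb
      simp only [mem_filter] at hb
      obtain ⟨j, hj⟩ := eB.surjective ⟨b, hb.1⟩
      obtain rfl : (eB j : V) = b := congrArg Subtype.val hj
      exact ⟨j, by simpa using (hr i j).1 hb.2, rfl⟩
  have hcol : ∀ b ∈ B, #{a ∈ A | r a b} = m := by
    intro b hb
    obtain ⟨j, hj⟩ := eB.surjective ⟨b, hb⟩
    obtain rfl : (eB j : V) = b := congrArg Subtype.val hj
    refine Eq.trans (Eq.symm ?_) (card_unbalanced_column m j)
    refine card_bij (fun i _ => (eA i : V)) ?_ (fun _ _ _ _ e => eA.injective (Subtype.ext e)) ?_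
    · intro i hi
      simp only [mem_filter, mem_univ, true_and] at hi ⊢
      exact ⟨(eA i).2, (hr i j).2 hi⟩
    · intro a ha
      simp only [mem_filter] at ha
      obtain ⟨i, hi⟩ := eA.surjective ⟨a, ha.1⟩
      obtain rfl : (eA i : V) = a := congrArg Subtype.val hi
      exact ⟨i, by simpa using (hr i j).1 ha.2, rfl⟩
  obtain ⟨σ, hσ⟩ := hsw (rewire G A B r) (deg_rewire hAB
    (fun a ha => (hrow a ha).trans (hAm a ha).symm) fun b hb => (hcol b hb).trans (hBm b hb).symm)
  have hadj : ∀ i j, (rewire G A B r).Adj (eA i) (eB j) ↔ unbalanced m i j := fun i j =>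
    (rewire_adj_mem hAB (eA i).2 (eB j).2).trans (hr i j)
  have himg : ∀ i, ∃ j, (eB j : V) = σ (eA i) := by
    intro i
    obtain ⟨j, hj⟩ := eB.surjective ⟨_, (hσ.1 _).2 (eA i).2⟩
    exact ⟨j, congrArg Subtype.val hj⟩
  -- For m ≥ 3 the rows `inr 1` and `inr 2` coincide, so σ would send them to two coinciding
  -- columns.
  obtain ⟨j₁, hj₁⟩ := himg (.inr ⟨1, by omega⟩)
  obtain ⟨j₂, hj₂⟩ := himg (.inr ⟨2, by omega⟩)
  have hcolumn : ∀ k (hk : k < m) (_ : k ≠ 0) j, (eB j : V) = σ (eA (.inr ⟨k, hk⟩)) →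
      ∀ i j', (eA i : V) = σ (eB j') → (unbalanced m i j ↔ j'.isRight) := by
    intro k hk hk0 j hj i j' hi
    have hne : (eB j' : V) ≠ eA (.inr ⟨k, hk⟩) := fun e =>
      disjoint_left.1 hAB (eA (.inr ⟨k, hk⟩)).2 (e ▸ (eB j').2)
    have hk0' : (⟨k, hk⟩ : Fin m) ≠ 0 := by simpa [Fin.ext_iff] using hk0
    rw [← hadj, hi, hj, antimorphism_adj σ hne, SimpleGraph.adj_comm, hadj]
    rcases j' with j' | j' <;> simp [unbalanced, hk0']
  have heq : j₁ = j₂ := by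
    refine unbalanced_column_injective (by omega) fun i => ?_
    obtain ⟨w, hw⟩ := σ.surjective (eA i)
    obtain ⟨j', hj'⟩ := eB.surjective ⟨w, (hσ.2 w).1 (hw ▸ (eA i).2)⟩
    have hi : (eA i : V) = σ (eB j') := by rw [hj', hw]
    rw [hcolumn 1 _ one_ne_zero j₁ hj₁ i j' hi, hcolumn 2 _ two_ne_zero j₂ hj₂ i j' hi]
  rw [heq, hj₂] at hj₁
  have := eA.injective (Subtype.ext (σ.injective hj₁))
  simp [Fin.ext_iff] at this

/-! ### Recognizing the blocks -/

theorem induce_iso_splitGraph {V : Type u} {G : SimpleGraph V} {A B : Finset V} {T : Set V}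
    (hT : ∀ v, v ∈ T ↔ v ∈ A ∨ v ∈ B) (hAB : Disjoint A B)
    (hclique : ∀ v ∈ A, ∀ w ∈ A, w ≠ v → G.Adj v w) (hindep : ∀ v ∈ B, ∀ w ∈ B, ¬ G.Adj v w)
    {I J : Type} {r : I → J → Prop} {a : I → V} {b : J → V} (ha : Function.Injective a)
    (hb : Function.Injective b) (hA : ∀ v, v ∈ A ↔ ∃ i, a i = v) (hB : ∀ v, v ∈ B ↔ ∃ j, b j = v)
    (hr : ∀ i j, G.Adj (a i) (b j) ↔ r i j) : Nonempty (G.induce T ≃g splitGraph r) := by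
  have haA : ∀ i, a i ∈ A := fun i => (hA _).2 ⟨i, rfl⟩
  have hbB : ∀ j, b j ∈ B := fun j => (hB _).2 ⟨j, rfl⟩
  let g : I ⊕ J → T := Sum.elim (fun i => ⟨a i, (hT _).2 (.inl (haA i))⟩)
    (fun j => ⟨b j, (hT _).2 (.inr (hbB j))⟩)
  have hg : Function.Bijective g := by
    constructor
    · rintro (i | j) (i' | j') h <;>
        simp only [g, Sum.elim_inl, Sum.elim_inr, Subtype.mk.injEq] at h
      · rw [ha h]
      · exact absurd (hbB j') (disjoint_left.1 hAB (h ▸ haA i))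
      · exact absurd (hbB j) (disjoint_left.1 hAB (h ▸ haA i'))
      · rw [hb h]
    · rintro ⟨v, hv⟩
      rcases (hT v).1 hv with h | h
      · obtain ⟨i, rfl⟩ := (hA v).1 h
        exact ⟨.inl i, rfl⟩
      · obtain ⟨j, rfl⟩ := (hB v).1 h
        exact ⟨.inr j, rfl⟩
  refine ⟨SimpleGraph.Iso.symm ⟨Equiv.ofBijective g hg, ?_⟩⟩
  rintro (i | j) (i' | j')
  · change G.Adj (a i) (a i') ↔ i ≠ i'
    constructor
    · rintro h rfl
      exact G.irrefl h
    · exact fun h => hclique _ (haA i) _ (haA i') fun e => h (ha e).symm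
  · exact hr i j'
  · exact (G.adj_comm _ _).trans (hr i' j)
  · change G.Adj (b j) (b j') ↔ False
    simpa using hindep _ (hbB j) _ (hbB j')

theorem exists_matching_two {V : Type u} {r : V → V → Prop} {A B : Finset V} (hA : #A = 2) (hB : #B = 2)
    (hrow : ∀ a ∈ A, #{b ∈ B | r a b} = 1) (hcol : ∀ b ∈ B, #{a ∈ A | r a b} = 1) :
    ∃ a b : Fin 2 → V, Function.Injective a ∧ Function.Injective b ∧ (∀ v, v ∈ A ↔ ∃ i, a i = v) ∧
      (∀ v, v ∈ B ↔ ∃ j, b j = v) ∧ ∀ i j, r (a i) (b j) ↔ i = j := by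
  obtain ⟨x₀, x₁, hx, rfl⟩ := card_eq_two.1 hA
  obtain ⟨y₀, hy₀⟩ := card_eq_one.1 (hrow x₀ (by simp))
  have hy₀' : y₀ ∈ ({b ∈ B | r x₀ b} : Finset V) := by simp [hy₀]
  rw [mem_filter] at hy₀'
  obtain ⟨y₁, hy₁⟩ : ∃ y₁, B.erase y₀ = {y₁} := by
    rw [← card_eq_one, card_erase_of_mem hy₀'.1, hB]
  have hB' : B = {y₀, y₁} := by rw [← insert_erase hy₀'.1, hy₁]
  have hy : y₀ ≠ y₁ := by
    have : y₁ ∈ B.erase y₀ := by simp [hy₁]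
    exact (ne_of_mem_erase this).symm
  subst hB'
  simp only [mem_insert, mem_singleton, forall_eq_or_imp, forall_eq, card_filter,
    sum_pair hx, sum_pair hy] at hrow hcol
  have h00 := hy₀'.2
  have h01 : ¬ r x₀ y₁ := by grind
  have h10 : ¬ r x₁ y₀ := by grind
  have h11 : r x₁ y₁ := by grind
  refine ⟨![x₀, x₁], ![y₀, y₁], ?_, ?_, ?_, ?_, ?_⟩
  · intro i j; fin_cases i <;> fin_cases j <;> simp [hx, hx.symm]
  · intro i j; fin_cases i <;> fin_cases j <;> simp [hy, hy.symm]
  · intro v; simp [Fin.exists_fin_two, eq_comm]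
  · intro v; simp [Fin.exists_fin_two, eq_comm]
  · intro i j; fin_cases i <;> fin_cases j <;> simp [h00, h01, h10, h11]

theorem injective_vec_four {V : Type u} {x₀ x₁ x₂ x₃ : V}
    (h : x₀ ≠ x₁ ∧ x₀ ≠ x₂ ∧ x₀ ≠ x₃ ∧ x₁ ≠ x₂ ∧ x₁ ≠ x₃ ∧ x₂ ≠ x₃) :
    Function.Injective ![x₀, x₁, x₂, x₃] := by
  obtain ⟨h1, h2, h3, h4, h5, h6⟩ := h
  intro i j
  fin_cases i <;> fin_cases j <;>
    simp [h1, h2, h3, h4, h5, h6, h1.symm, h2.symm, h3.symm, h4.symm, h5.symm, h6.symm]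

theorem mem_vec_four {V : Type u} {x₀ x₁ x₂ x₃ v : V} :
    (∃ i, ![x₀, x₁, x₂, x₃] i = v) ↔ v = x₀ ∨ v = x₁ ∨ v = x₂ ∨ v = x₃ := by
  simp [Fin.exists_fin_succ, eq_comm]

theorem card_filter_four {V : Type u} {x₀ x₁ x₂ x₃ : V}
    (h : x₀ ≠ x₁ ∧ x₀ ≠ x₂ ∧ x₀ ≠ x₃ ∧ x₁ ≠ x₂ ∧ x₁ ≠ x₃ ∧ x₂ ≠ x₃)
    (q : V → Prop) : #{x ∈ ({x₀, x₁, x₂, x₃} : Finset V) | q x} =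
      (if q x₀ then 1 else 0) + ((if q x₁ then 1 else 0) +
        ((if q x₂ then 1 else 0) + (if q x₃ then 1 else 0))) := by
  obtain ⟨h1, h2, h3, h4, h5, h6⟩ := h
  rw [card_filter, sum_insert (by simp [h1, h2, h3]), sum_insert (by simp [h4, h5]), sum_pair h6]

theorem exists_fourth {V : Type u} {S : Finset V} (hS : #S = 4) {x y z : V} (hx : x ∈ S)
    (hy : y ∈ S) (hz : z ∈ S) (hxy : x ≠ y) (hxz : x ≠ z) (hyz : y ≠ z) :
    ∃ w, x ≠ w ∧ y ≠ w ∧ z ≠ w ∧ S = {x, y, z, w} := by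
  have h3 : #({x, y, z} : Finset V) = 3 := by simp [hxy, hxz, hyz]
  have hsub : ({x, y, z} : Finset V) ⊆ S := by
    intro t; simp only [mem_insert, mem_singleton]; rintro (rfl | rfl | rfl) <;> assumption
  obtain ⟨w, hw⟩ : ∃ w, S \ {x, y, z} = {w} := by
    rw [← card_eq_one, card_sdiff_of_subset hsub, h3, hS]
  have hw' : w ∈ S \ {x, y, z} := by simp [hw]
  simp only [mem_sdiff, mem_insert, mem_singleton, not_or] at hw'
  refine ⟨w, Ne.symm hw'.2.1, Ne.symm hw'.2.2.1, Ne.symm hw'.2.2.2, ?_⟩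
  rw [← sdiff_union_of_subset hsub, hw]
  ext t
  simp only [mem_union, mem_singleton, mem_insert]
  tauto

theorem exists_third {V : Type u} {S : Finset V} (hS : #S = 4) (x y : V) :
    ∃ z ∈ S, x ≠ z ∧ y ≠ z := by
  have : ∃ z ∈ S, z ∉ ({x, y} : Finset V) := by
    by_contra! h
    have := card_le_card (show S ⊆ {x, y} from h)
    have := card_le_two (a := x) (b := y)
    omega
  obtain ⟨z, hz, h⟩ := this
  simp only [mem_insert, mem_singleton, not_or] at h
  exact ⟨z, hz, Ne.symm h.1, Ne.symm h.2⟩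

theorem exists_second_of_card {V : Type u} {S : Finset V} {q : V → Prop}
    (hS : #{x ∈ S | q x} = 2) (x : V) : ∃ y ∈ S, q y ∧ x ≠ y := by
  obtain ⟨y, hy, hne⟩ := exists_mem_ne (s := ({x ∈ S | q x} : Finset V)) (by omega) x
  rw [mem_filter] at hy
  exact ⟨y, hy.1, hy.2, hne.symm⟩

/-- A bipartite graph of degree two with sides of size four is an 8-cycle or two 4-cycles. -/
theorem eight_cycle_or_two_four_cycles {V : Type u} {r : V → V → Prop} {A B : Finset V}
    (hA : #A = 4) (hB : #B = 4) (hrow : ∀ a ∈ A, #{b ∈ B | r a b} = 2)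
    (hcol : ∀ b ∈ B, #{a ∈ A | r a b} = 2) :
    ∃ a b : Fin 4 → V, Function.Injective a ∧ Function.Injective b ∧ (∀ v, v ∈ A ↔ ∃ i, a i = v) ∧
      (∀ v, v ∈ B ↔ ∃ j, b j = v) ∧ ((∀ i j, r (a i) (b j) ↔ j = i ∨ j = i + 1) ∨
        ∀ i j, r (a i) (b j) ↔ i.val / 2 = j.val / 2) := by
  obtain ⟨x₀, hx₀⟩ : A.Nonempty := card_pos.1 (by omega)
  obtain ⟨y₀, hy₀, h00, -⟩ := exists_second_of_card (hrow x₀ hx₀) x₀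
  obtain ⟨y₁, hy₁, h01, hy01⟩ := exists_second_of_card (hrow x₀ hx₀) y₀
  obtain ⟨x₁, hx₁, h10, hx01⟩ := exists_second_of_card (hcol y₀ hy₀) x₀
  -- The path x₁ y₀ x₀ y₁ either closes to a 4-cycle, leaving a second one on the other vertices, or
  -- extends to an 8-cycle.
  by_cases h11 : r x₁ y₁
  · obtain ⟨x₂, hx₂, hx02, hx12⟩ := exists_third hA x₀ x₁
    obtain ⟨x₃, hx03, hx13, hx23, hA'⟩ := exists_fourth hA hx₀ hx₁ hx₂ hx01 hx02 hx12
    obtain ⟨y₂, hy₂, hy02, hy12⟩ := exists_third hB y₀ y₁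
    obtain ⟨y₃, hy03, hy13, hy23, hB'⟩ := exists_fourth hB hy₀ hy₁ hy₂ hy01 hy02 hy12
    have hx : x₀ ≠ x₁ ∧ x₀ ≠ x₂ ∧ x₀ ≠ x₃ ∧ x₁ ≠ x₂ ∧ x₁ ≠ x₃ ∧ x₂ ≠ x₃ :=
      ⟨hx01, hx02, hx03, hx12, hx13, hx23⟩
    have hy : y₀ ≠ y₁ ∧ y₀ ≠ y₂ ∧ y₀ ≠ y₃ ∧ y₁ ≠ y₂ ∧ y₁ ≠ y₃ ∧ y₂ ≠ y₃ :=
      ⟨hy01, hy02, hy03, hy12, hy13, hy23⟩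
    subst hA' hB'
    simp only [mem_insert, mem_singleton, forall_eq_or_imp, forall_eq, card_filter_four hx,
      card_filter_four hy] at hrow hcol
    obtain ⟨e0, e1, e2, e3⟩ := hrow
    obtain ⟨f0, f1, f2, f3⟩ := hcol
    have h02 : ¬ r x₀ y₂ := by grind
    have h03 : ¬ r x₀ y₃ := by grind
    have h12 : ¬ r x₁ y₂ := by grind
    have h13 : ¬ r x₁ y₃ := by grind
    have h20 : ¬ r x₂ y₀ := by grind
    have h30 : ¬ r x₃ y₀ := by grind
    have h21 : ¬ r x₂ y₁ := by grind
    have h31 : ¬ r x₃ y₁ := by grind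
    have h22 : r x₂ y₂ := by grind
    have h23 : r x₂ y₃ := by grind
    have h32 : r x₃ y₂ := by grind
    have h33 : r x₃ y₃ := by grind
    refine ⟨![x₀, x₁, x₂, x₃], ![y₀, y₁, y₂, y₃], injective_vec_four hx, injective_vec_four hy,
      fun v => by rw [mem_vec_four]; simp, fun v => by rw [mem_vec_four]; simp, Or.inr ?_⟩
    intro i j
    fin_cases i <;> fin_cases j <;> simp [*]
  · obtain ⟨x₂, hx₂, h21, hx02⟩ := exists_second_of_card (hcol y₁ hy₁) x₀
    have hx12 : x₁ ≠ x₂ := by rintro rfl; exact h11 h21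
    obtain ⟨x₃, hx03, hx13, hx23, hA'⟩ := exists_fourth hA hx₀ hx₁ hx₂ hx01 hx02 hx12
    obtain ⟨y₂, hy₂, h12, hy02⟩ := exists_second_of_card (hrow x₁ hx₁) y₀
    have hy12 : y₁ ≠ y₂ := by rintro rfl; exact h11 h12
    obtain ⟨y₃, hy03, hy13, hy23, hB'⟩ := exists_fourth hB hy₀ hy₁ hy₂ hy01 hy02 hy12
    have hx : x₀ ≠ x₁ ∧ x₀ ≠ x₂ ∧ x₀ ≠ x₃ ∧ x₁ ≠ x₂ ∧ x₁ ≠ x₃ ∧ x₂ ≠ x₃ :=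
      ⟨hx01, hx02, hx03, hx12, hx13, hx23⟩
    have hy : y₀ ≠ y₁ ∧ y₀ ≠ y₂ ∧ y₀ ≠ y₃ ∧ y₁ ≠ y₂ ∧ y₁ ≠ y₃ ∧ y₂ ≠ y₃ :=
      ⟨hy01, hy02, hy03, hy12, hy13, hy23⟩
    subst hA' hB'
    simp only [mem_insert, mem_singleton, forall_eq_or_imp, forall_eq, card_filter_four hx,
      card_filter_four hy] at hrow hcol
    obtain ⟨e0, e1, e2, e3⟩ := hrow
    obtain ⟨f0, f1, f2, f3⟩ := hcol
    have h02 : ¬ r x₀ y₂ := by grind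
    have h03 : ¬ r x₀ y₃ := by grind
    have h20 : ¬ r x₂ y₀ := by grind
    have h30 : ¬ r x₃ y₀ := by grind
    have h13 : ¬ r x₁ y₃ := by grind
    have h31 : ¬ r x₃ y₁ := by grind
    have h23 : r x₂ y₃ := by grind
    have h33 : r x₃ y₃ := by grind
    have h22 : ¬ r x₂ y₂ := by grind
    have h32 : r x₃ y₂ := by grind
    -- The numbering follows the cycle y₁ x₀ y₀ x₁ y₂ x₃ y₃ x₂.
    refine ⟨![x₀, x₁, x₃, x₂], ![y₁, y₀, y₂, y₃], 
      injective_vec_four ⟨hx01, hx03, hx02, hx13, hx12, hx23.symm⟩,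
      injective_vec_four ⟨hy01.symm, hy12, hy13, hy02, hy03, hy23⟩, fun v => ?_, fun v => ?_, Or.inl ?_⟩
    · rw [mem_vec_four]; simp only [mem_insert, mem_singleton]; rw [or_comm (a := v = x₂)]
    · rw [mem_vec_four]; simp only [mem_insert, mem_singleton]; rw [or_left_comm]
    intro i j
    fin_cases i <;> fin_cases j <;> simp [*]

/-! ### The regular case -/

/-- The complete bipartite graph with sides of size `2 * k` in which a matching of size `k` is
replaced by edges from its ends to a new vertex. -/
def apexBipartite (k : ℕ) : SimpleGraph (Option (Bool × (Fin k ⊕ Fin k))) where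
  Adj x y :=
    match x, y with
    | none, none => False
    | none, some (_, y) => y.isLeft
    | some (_, x), none => x.isLeft
    | some (b, x), some (c, y) => b ≠ c ∧ ¬ (x = y ∧ x.isLeft)
  symm := ⟨by
    rintro (_ | ⟨b, x⟩) (_ | ⟨c, y⟩) h
    · exact h
    · exact h
    · exact h
    · exact ⟨h.1.symm, fun h' => h.2 ⟨h'.1.symm, h'.1 ▸ h'.2⟩⟩⟩
  loopless := ⟨by
    rintro (_ | ⟨b, x⟩) h
    · exact h
    · exact h.1 rfl⟩

theorem deg_apexBipartite (k : ℕ) (v : Option (Bool × (Fin k ⊕ Fin k))) :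
    deg (apexBipartite k) v = 2 * k := by
  have hinj : ∀ b : Bool, Function.Injective
      (fun y : Fin k ⊕ Fin k => (some (b, y) : Option (Bool × (Fin k ⊕ Fin k)))) := by
    intro b y y' h
    simpa using h
  rcases v with _ | ⟨b, i | i⟩
  · have : ({w | (apexBipartite k).Adj none w} : Finset _) =
        (univ : Finset (Bool × Fin k)).image fun x => some (x.1, Sum.inl x.2) := by
      ext (_ | ⟨c, j | j⟩) <;> simp [apexBipartite]
    rw [deg, this, card_image_of_injective]
    · simp
    · rintro ⟨c, j⟩ ⟨c', j'⟩ h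
      simpa using h
  · have : ({w | (apexBipartite k).Adj (some (b, .inl i)) w} : Finset _) =
        insert none ((univ.erase (Sum.inl i)).image fun y => some (!b, y)) := by
      ext (_ | ⟨_ | _, j | j⟩) <;> cases b <;> simp [apexBipartite, eq_comm (a := i)]
    rw [deg, this, card_insert_of_notMem (by simp), card_image_of_injective _ (hinj _),
      card_erase_add_one (mem_univ _)]
    simp [two_mul]
  · have : ({w | (apexBipartite k).Adj (some (b, .inr i)) w} : Finset _) =
        univ.image fun y => some (!b, y) := by
      ext (_ | ⟨_ | _, j | j⟩) <;> cases b <;> simp [apexBipartite]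
    rw [deg, this, card_image_of_injective _ (hinj _)]
    simp [two_mul]

/-- One side contains four independent vertices as 2k ≥ 4. An antimorphism would map them to a
4-clique, but the two sides and the apex are three colour classes. -/
theorem apexBipartite_not_isSelfComplementary {k : ℕ} (hk : 2 ≤ k) :
    ¬ IsSelfComplementary (apexBipartite k) := by
  rintro ⟨σ⟩
  let f : Bool × Bool → Option (Bool × (Fin k ⊕ Fin k)) := fun x =>
    some (true, if x.1 then .inl ⟨x.2.toNat, by cases x.2 <;> simp <;> omega⟩
      else .inr ⟨x.2.toNat, by cases x.2 <;> simp <;> omega⟩)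
  have hf : ∀ x y, x ≠ y → f x ≠ f y ∧ ¬ (apexBipartite k).Adj (f x) (f y) := by
    intro x y hxy
    refine ⟨fun h => hxy ?_, fun h => h.1 rfl⟩
    rcases x with ⟨_ | _, _ | _⟩ <;> rcases y with ⟨_ | _, _ | _⟩ <;> simp [f] at h ⊢
  have hcol : ∀ v w, (apexBipartite k).Adj v w → v.map Prod.fst ≠ w.map Prod.fst := by
    rintro (_ | ⟨b, x⟩) (_ | ⟨c, y⟩) h
    · exact h.elim
    · simp
    · simp
    · simpa using h.1
  have hinj : Function.Injective fun x => (σ (f x)).map Prod.fst := by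
    intro x y h
    by_contra hxy
    have := hf x y hxy
    exact hcol _ _ ((antimorphism_adj σ this.1).2 this.2) h
  have := Fintype.card_le_of_injective _ hinj
  simp at this

theorem deg_iso {V W : Type*} [Fintype V] [Fintype W] {G : SimpleGraph V} {H : SimpleGraph W}
    (e : G ≃g H) (v : V) : deg H (e v) = deg G v := by
  symm
  refine card_bij (fun w _ => e w) ?_ (fun _ _ _ _ h => e.injective h) ?_
  · intro w hw
    simpa [e.map_adj_iff] using hw
  · intro w hw
    obtain ⟨w, rfl⟩ := e.surjective w
    exact ⟨w, by simpa [e.map_adj_iff] using hw, rfl⟩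

theorem deg_eq_sum_five {G : SimpleGraph V} (x : Fin 5 ≃ V) (v : V) :
    deg G v = (if G.Adj v (x 0) then 1 else 0) + (if G.Adj v (x 1) then 1 else 0) +
      (if G.Adj v (x 2) then 1 else 0) + (if G.Adj v (x 3) then 1 else 0) +
      (if G.Adj v (x 4) then 1 else 0) := by
  rw [deg, card_filter, ← Equiv.sum_comp x, Fin.sum_univ_five]

theorem injective_vec_five {V : Type u} {x₀ x₁ x₂ x₃ x₄ : V} (h1 : x₀ ≠ x₁) (h2 : x₀ ≠ x₂)
    (h3 : x₀ ≠ x₃) (h4 : x₀ ≠ x₄) (h5 : x₁ ≠ x₂) (h6 : x₁ ≠ x₃) (h7 : x₁ ≠ x₄) (h8 : x₂ ≠ x₃)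
    (h9 : x₂ ≠ x₄) (h10 : x₃ ≠ x₄) : Function.Injective ![x₀, x₁, x₂, x₃, x₄] := by
  intro i j
  fin_cases i <;> fin_cases j <;>
    simp [h1, h2, h3, h4, h5, h6, h7, h8, h9, h10, h1.symm, h2.symm, h3.symm, h4.symm, h5.symm,
      h6.symm, h7.symm, h8.symm, h9.symm, h10.symm]

theorem exists_not_mem_of_card_five (hV : Fintype.card V = 5) {S : Finset V} (hS : #S < 5) :
    ∃ v, v ∉ S := by
  by_contra! h
  rw [eq_univ_iff_forall.2 h, card_univ] at hS
  omega

/-- Let v have neighbours a, b, and let c be the other neighbour of a. If c = b, there is a triangle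
and the two vertices left over cannot have degree 2; otherwise the fifth vertex d closes the cycle v
a c d b. -/
theorem iso_cycleGraph_five {G : SimpleGraph V} (hV : Fintype.card V = 5)
    (hdeg : ∀ v, deg G v = 2) : Nonempty (G ≃g SimpleGraph.cycleGraph 5) := by
  have hbij : ∀ x : Fin 5 → V, Function.Injective x → Function.Bijective x := fun x hx =>
    (Fintype.bijective_iff_injective_and_card x).2 ⟨hx, by simp [hV]⟩
  obtain ⟨v⟩ : Nonempty V := Fintype.card_pos_iff.1 (by omega)
  obtain ⟨a, -, hva, -⟩ := exists_second_of_card (hdeg v) v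
  obtain ⟨b, -, hvb, hab⟩ := exists_second_of_card (hdeg v) a
  obtain ⟨c, -, hac, hvc⟩ := exists_second_of_card (hdeg a) v
  have hirr := fun x => G.irrefl (v := x)
  by_cases hcb : c = b
  · exfalso
    subst hcb
    obtain ⟨d, hd⟩ := exists_not_mem_of_card_five hV (S := {v, a, c})
      (card_le_three.trans_lt (by omega))
    obtain ⟨e, he⟩ := exists_not_mem_of_card_five hV (S := {v, a, c, d})
      (card_le_four.trans_lt (by omega))
    simp only [mem_insert, mem_singleton, not_or] at hd he
    let x : Fin 5 ≃ V := Equiv.ofBijective ![v, a, c, d, e] (hbij _ (injective_vec_five hva.ne hvc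
      (Ne.symm hd.1) (Ne.symm he.1) hab (Ne.symm hd.2.1) (Ne.symm he.2.1) (Ne.symm hd.2.2)
      (Ne.symm he.2.2.1) (Ne.symm he.2.2.2)))
    have hs : ∀ w, (if G.Adj w v then 1 else 0) + (if G.Adj w a then 1 else 0) +
      (if G.Adj w c then 1 else 0) + (if G.Adj w d then 1 else 0) +
      (if G.Adj w e then 1 else 0) = 2 := fun w => (deg_eq_sum_five x w).symm.trans (hdeg w)
    have h1 : ¬ G.Adj v d := by have := hs v; grind
    have h2 : ¬ G.Adj a d := by have := hs a; have := hva.symm; grind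
    have h3 : ¬ G.Adj c d := by have := hs c; have := hac.symm; have := hvb.symm; grind
    have := hs d
    rw [if_neg (fun h => h1 h.symm), if_neg (fun h => h2 h.symm), if_neg (fun h => h3 h.symm),
      if_neg (hirr d)] at this
    split_ifs at this
    all_goals omega
  · obtain ⟨d, hd⟩ := exists_not_mem_of_card_five hV (S := {v, a, c, b})
      (card_le_four.trans_lt (by omega))
    simp only [mem_insert, mem_singleton, not_or] at hd
    let x : Fin 5 ≃ V := Equiv.ofBijective ![v, a, c, d, b] (hbij _ (injective_vec_five hva.ne hvc
      (Ne.symm hd.1) hvb.ne hac.ne (Ne.symm hd.2.1) hab (Ne.symm hd.2.2.1) hcb hd.2.2.2))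
    have hs : ∀ w, (if G.Adj w v then 1 else 0) + (if G.Adj w a then 1 else 0) +
      (if G.Adj w c then 1 else 0) + (if G.Adj w d then 1 else 0) +
      (if G.Adj w b then 1 else 0) = 2 := fun w => (deg_eq_sum_five x w).symm.trans (hdeg w)
    have hav := hva.symm
    have hbv := hvb.symm
    have hca := hac.symm
    have n1 : ¬ G.Adj v c := by have := hs v; grind
    have n2 : ¬ G.Adj v d := by have := hs v; grind
    have n3 : ¬ G.Adj a d := by have := hs a; grind
    have n4 : ¬ G.Adj a b := by have := hs a; grind
    have n1' : ¬ G.Adj c v := fun h => n1 h.symm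
    have n2' : ¬ G.Adj d v := fun h => n2 h.symm
    have n3' : ¬ G.Adj d a := fun h => n3 h.symm
    have n4' : ¬ G.Adj b a := fun h => n4 h.symm
    have hdc : G.Adj d c := by have := hs d; have := hirr d; grind
    have hdb : G.Adj d b := by have := hs d; have := hirr d; grind
    have hcd := hdc.symm
    have hbd := hdb.symm
    have n5 : ¬ G.Adj b c := by have := hs b; grind
    have n5' : ¬ G.Adj c b := fun h => n5 h.symm
    refine ⟨SimpleGraph.Iso.symm ⟨x, ?_⟩⟩
    intro i j
    change G.Adj (![v, a, c, d, b] i) (![v, a, c, d, b] j) ↔ _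
    fin_cases i <;> fin_cases j <;> simp [SimpleGraph.cycleGraph_adj, *] <;> decide

/-- Self-complementarity gives n = 2 deg + 1, which is odd; n · deg is even, so deg = 2k and n = 4k
+ 1. The values k = 0, 1 give the nonempty cores. -/
theorem ForcesSC.isCore_of_regular {G : SimpleGraph V} (hG : ForcesSC G)
    (hreg : ∀ v w, deg G v = deg G w) : IsCore G := by
  rcases isEmpty_or_nonempty V with h | ⟨⟨v⟩⟩
  · exact Or.inl h
  obtain ⟨σ⟩ := hG G fun _ => rfl
  have h1 := deg_antimorphism σ v
  rw [hreg (σ v) v] at h1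
  have h2 : ∑ w, deg G w = 2 * #G.edgeFinset := by
    rw [← SimpleGraph.sum_degrees_eq_twice_card_edges]
    exact sum_congr rfl fun w _ => deg_eq_degree G w
  rw [sum_congr rfl fun w _ => hreg w v, sum_const, card_univ, smul_eq_mul, ← h1] at h2
  obtain ⟨k, hk⟩ : ∃ k, deg G v = 2 * k := by
    have : Even ((deg G v + deg G v + 1) * deg G v) := ⟨_, by rw [h2]; ring⟩
    rw [Nat.even_mul] at this
    rcases this with h | h
    · exact absurd h (by simp [parity_simps])
    · obtain ⟨k, hk⟩ := h
      exact ⟨k, by omega⟩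
  have hcard : Fintype.card V = 4 * k + 1 := by omega
  rcases Nat.lt_or_ge k 2 with hk2 | hk2
  · interval_cases k
    · exact Or.inr (Or.inl (Fintype.card_eq_one_iff_nonempty_unique.1 (by omega)))
    · exact Or.inr (Or.inr (iso_cycleGraph_five (by omega) fun w => (hreg w v).trans hk))
  · exfalso
    have e : V ≃ Option (Bool × (Fin k ⊕ Fin k)) :=
      Fintype.equivOfCardEq (by simp [hcard]; ring)
    let g : (apexBipartite k).comap e ≃g apexBipartite k := SimpleGraph.Iso.comap e _
    refine apexBipartite_not_isSelfComplementary hk2 ((hG ((apexBipartite k).comap e) ?_).of_iso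
      g.symm)
    intro w
    rw [hreg w v, hk, ← deg_iso g, deg_apexBipartite]

/-! ### Removing the vertices of extremal degree -/

/-- Replace the subgraph of `G` induced by `R` by `F`. -/
def patch {V : Type u} (G : SimpleGraph V) (R : Set V) (F : SimpleGraph R) : SimpleGraph V where
  Adj x y := (∃ (hx : x ∈ R) (hy : y ∈ R), F.Adj ⟨x, hx⟩ ⟨y, hy⟩) ∨
    (G.Adj x y ∧ ¬ (x ∈ R ∧ y ∈ R))
  symm := ⟨by
    rintro x y (⟨hx, hy, h⟩ | ⟨h, h'⟩)
    · exact .inl ⟨hy, hx, h.symm⟩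
    · exact .inr ⟨h.symm, fun h'' => h' h''.symm⟩⟩
  loopless := ⟨by
    rintro x (⟨hx, hy, h⟩ | ⟨h, h'⟩)
    · exact F.irrefl h
    · exact G.irrefl h⟩

theorem patch_adj_mem {V : Type u} {G : SimpleGraph V} {R : Set V} {F : SimpleGraph R} {x y : V}
    (hx : x ∈ R) (hy : y ∈ R) : (patch G R F).Adj x y ↔ F.Adj ⟨x, hx⟩ ⟨y, hy⟩ := by
  simp [patch, hx, hy]

theorem patch_adj_of_not {V : Type u} {G : SimpleGraph V} {R : Set V} {F : SimpleGraph R}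
    {x y : V} (h : ¬ (x ∈ R ∧ y ∈ R)) : (patch G R F).Adj x y ↔ G.Adj x y := by
  simp only [patch]
  constructor
  · rintro (⟨hx, hy, -⟩ | h')
    · exact absurd ⟨hx, hy⟩ h
    · exact h'.1
  · exact fun h' => .inr ⟨h', h⟩

theorem deg_subtype {R : Set V} (F : SimpleGraph R) {H : SimpleGraph V}
    (hH : ∀ x y : R, H.Adj x y ↔ F.Adj x y) (v : R) :
    deg F v = #{w ∈ R.toFinset | H.Adj v w} := by
  refine card_bij (fun w _ => (w : V)) ?_ (fun _ _ _ _ h => Subtype.ext h) ?_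
  · intro w hw
    simpa [hH] using hw
  · intro w hw
    simp only [mem_filter, Set.mem_toFinset] at hw
    exact ⟨⟨w, hw.1⟩, by simpa using (hH v ⟨w, hw.1⟩).1 hw.2, rfl⟩

theorem deg_patch {G : SimpleGraph V} {R : Set V} {F : SimpleGraph R}
    (hF : ∀ v, deg F v = deg (G.induce R) v) (v : V) : deg (patch G R F) v = deg G v := by
  by_cases hv : v ∈ R
  · refine deg_congr R.toFinset ?_ fun w hw => patch_adj_of_not fun h => hw (by simpa using h.2)
    have h1 := deg_subtype F (H := patch G R F) (fun x y => patch_adj_mem x.2 y.2) ⟨v, hv⟩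
    have h2 := deg_subtype (G.induce R) (H := G) (fun x y => Iff.rfl) ⟨v, hv⟩
    rw [← h1, ← h2, hF]
  · exact deg_congr ∅ (by simp) fun w _ => patch_adj_of_not fun h => hv h.1

/-- Patching a realization on R into G gives a realization of the degrees of G; its antimorphism
swaps A and B, hence preserves R and restricts to it. -/
theorem ForcesSC.induce {G : SimpleGraph V} {A B : Finset V} {R : Set V}
    (hR : ∀ v, v ∈ R ↔ v ∉ A ∧ v ∉ B)
    (hsw : ∀ H : SimpleGraph V, (∀ v, deg H v = deg G v) → ∃ σ : H ≃g Hᶜ, Swaps σ A B) :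
    ForcesSC (G.induce R) := by
  intro F hF
  obtain ⟨σ, hσ⟩ := hsw _ (deg_patch hF)
  have hσR : ∀ v, v ∈ R ↔ σ v ∈ R := by
    intro v
    rw [hR, hR, hσ.1, hσ.2, and_comm]
  refine ⟨⟨σ.toEquiv.subtypeEquiv hσR, ?_⟩⟩
  intro x y
  rw [SimpleGraph.compl_adj]
  by_cases hxy : x = y
  · subst hxy; simp
  have hne : (x : V) ≠ y := fun e => hxy (Subtype.ext e)
  have h1 := antimorphism_adj σ hne
  rw [patch_adj_mem ((hσR x).1 x.2) ((hσR y).1 y.2), patch_adj_mem x.2 y.2] at h1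
  have h2 : F.Adj (σ.toEquiv.subtypeEquiv hσR x) (σ.toEquiv.subtypeEquiv hσR y) ↔ ¬ F.Adj x y := h1
  rw [h2, not_not]
  exact and_iff_right_of_imp fun h e => h.ne ((Equiv.injective _) e)

/-- An induced subgraph of an induced subgraph is induced. -/
theorem induce_induce_iso {V : Type u} {G : SimpleGraph V} {R T : Set V} {T' : Set R}
    (hT : ∀ v, v ∈ T ↔ ∃ h : v ∈ R, (⟨v, h⟩ : R) ∈ T') :
    Nonempty (G.induce T ≃g (G.induce R).induce T') :=
  ⟨⟨⟨fun v => ⟨⟨v, ((hT v).1 v.2).1⟩, ((hT v).1 v.2).2⟩, fun v => ⟨v, (hT v).2 ⟨v.1.2, v.2⟩⟩,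
    fun _ => rfl, fun _ => rfl⟩, Iff.rfl⟩⟩

theorem IsBlock.of_iso {V W : Type u} {S : SimpleGraph V} {S' : SimpleGraph W} (e : S ≃g S')
    (h : IsBlock S') : IsBlock S := by
  rcases h with ⟨⟨g⟩⟩ | ⟨⟨g⟩⟩ | ⟨⟨g⟩⟩
  · exact .inl ⟨e.trans g⟩
  · exact .inr (.inl ⟨e.trans g⟩)
  · exact .inr (.inr ⟨e.trans g⟩)

theorem IsCore.of_iso {V W : Type u} {C : SimpleGraph V} {C' : SimpleGraph W} (e : C ≃g C')
    (h : IsCore C') : IsCore C := by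
  rcases h with h | ⟨⟨h⟩⟩ | ⟨⟨g⟩⟩
  · exact .inl (e.toEquiv.isEmpty)
  · exact .inr (.inl ⟨e.toEquiv.unique⟩)
  · exact .inr (.inr ⟨e.trans g⟩)

/-- In the situation of `ForcesSC.exists_extremal`, the vertices of extremal degree form a block. -/
theorem isBlock_extremal {V : Type u} {G : SimpleGraph V} {A B : Finset V} {m : ℕ} (hm0 : 0 < m) (hm : m ≤ 2)
    (hAB : Disjoint A B) (hA : #A = 2 * m) (hB : #B = 2 * m)
    (hclique : ∀ v ∈ A, ∀ w ∈ A, w ≠ v → G.Adj v w) (hindep : ∀ v ∈ B, ∀ w ∈ B, ¬ G.Adj v w)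
    (hBm : ∀ y ∈ B, #{a ∈ A | G.Adj y a} = m) (hAm : ∀ v ∈ A, #{b ∈ B | G.Adj v b} = m)
    {T : Set V} (hT : ∀ v, v ∈ T ↔ v ∈ A ∨ v ∈ B) : IsBlock (G.induce T) := by
  have hBm' : ∀ y ∈ B, #{a ∈ A | G.Adj a y} = m := by
    intro y hy
    rw [← hBm y hy]
    simp_rw [G.adj_comm y]
  interval_cases m
  · obtain ⟨a, b, ha, hb, haA, hbB, hr⟩ := exists_matching_two hA hB hAm hBm'
    obtain ⟨g⟩ := induce_iso_splitGraph hT hAB hclique hindep ha hb haA hbB hr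
    exact .inl ⟨g.trans pathGraphFourIso.symm⟩
  · obtain ⟨a, b, ha, hb, haA, hbB, hr | hr⟩ := eight_cycle_or_two_four_cycles hA hB hAm hBm'
    · exact .inr (.inl (induce_iso_splitGraph hT hAB hclique hindep ha hb haA hbB hr))
    · exact .inr (.inr (induce_iso_splitGraph hT hAB hclique hindep ha hb haA hbB hr))

/-- Adding a block in front of a layered graph. -/
theorem IsLayered.cons {V : Type u} {G : SimpleGraph V} {A B : Finset V} {R T : Set V}
    (hR : ∀ v, v ∈ R ↔ v ∉ A ∧ v ∉ B) (hT : ∀ v, v ∈ T ↔ v ∈ A ∨ v ∈ B) (hAB : Disjoint A B)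
    (hblock : IsBlock (G.induce T)) (hBadj : ∀ y ∈ B, ∀ z, G.Adj y z → z ∈ A)
    (hAadj : ∀ v ∈ A, ∀ w ∉ B, w ≠ v → G.Adj v w) (h : IsLayered (G.induce R)) :
    IsLayered G := by
  obtain ⟨p, f, K, hf, hlev, hcore, hadj⟩ := h
  -- The new block takes level 0, and every old level, including the core's, moves up by one.
  let f' : V → ℕ := fun v => if h : v ∈ R then f ⟨v, h⟩ + 1 else 0
  have hpos : ∀ v (h : v ∈ R), f' v = f ⟨v, h⟩ + 1 := fun v h => by simp [f', h]
  have hzero : ∀ v, v ∉ R → f' v = 0 := fun v h => by simp [f', h]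
  have hRT : ∀ v, v ∉ R ↔ v ∈ T := by
    intro v
    rw [hR, hT]
    tauto
  have hsucc : ∀ i v, v ∈ {v | f' v = i + 1} ↔ ∃ h : v ∈ R, (⟨v, h⟩ : R) ∈ {v | f v = i} := by
    intro i v
    by_cases hv : v ∈ R
    · simp [hpos v hv, hv]
    · simp [hzero v hv, hv]
  let K' : Set V := {v | v ∈ A ∨ ∃ h : v ∈ R, (⟨v, h⟩ : R) ∈ K}
  have hK'R : ∀ v (h : v ∈ R), v ∈ K' ↔ (⟨v, h⟩ : R) ∈ K := by
    intro v h
    have := ((hR v).1 h).1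
    simp [K', h, this]
  have hK'T : ∀ v, v ∉ R → (v ∈ K' ↔ v ∈ A) := by
    intro v h
    simp [K', h]
  refine ⟨p + 1, f', K', ?_, ?_, ?_, ?_⟩
  · intro v
    by_cases hv : v ∈ R
    · rw [hpos v hv]
      exact Nat.succ_le_succ (hf _)
    · simp [hzero v hv]
  · rintro (_ | i) hi
    · have hset : {v | f' v = 0} = T := by
        ext v
        rw [← hRT]
        by_cases hv : v ∈ R
        · simp [hpos v hv, hv]
        · simp [hzero v hv, hv]
      rw [hset]
      refine ⟨hblock, ?_, ?_⟩
      · rintro ⟨x, hx⟩ hxK ⟨y, hy⟩ hyK hxy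
        have hxA := (hK'T x ((hRT x).2 hx)).1 hxK
        have hyA := (hK'T y ((hRT y).2 hy)).1 hyK
        exact hAadj x hxA y (disjoint_left.1 hAB hyA) fun e => hxy (Subtype.ext e.symm)
      · rintro ⟨x, hx⟩ hxK ⟨y, hy⟩ hyK hxy hadj
        have hxA : x ∉ A := fun h => hxK ((hK'T x ((hRT x).2 hx)).2 h)
        have hyA : y ∉ A := fun h => hyK ((hK'T y ((hRT y).2 hy)).2 h)
        exact hyA (hBadj x (((hT x).1 hx).resolve_left hxA) y hadj)
    · obtain ⟨hb, hK1, hK2⟩ := hlev i (by omega)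
      obtain ⟨g⟩ := induce_induce_iso (G := G) (hsucc i)
      refine ⟨hb.of_iso g, ?_, ?_⟩
      · rintro ⟨x, hx⟩ hxK ⟨y, hy⟩ hyK hxy
        obtain ⟨hxR, hxi⟩ := (hsucc i x).1 hx
        obtain ⟨hyR, hyi⟩ := (hsucc i y).1 hy
        exact hK1 (x := ⟨⟨x, hxR⟩, hxi⟩) ((hK'R x hxR).1 hxK) (y := ⟨⟨y, hyR⟩, hyi⟩)
          ((hK'R y hyR).1 hyK) fun e => hxy (by simpa using e)
      · rintro ⟨x, hx⟩ hxK ⟨y, hy⟩ hyK hxy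
        obtain ⟨hxR, hxi⟩ := (hsucc i x).1 hx
        obtain ⟨hyR, hyi⟩ := (hsucc i y).1 hy
        exact hK2 (x := ⟨⟨x, hxR⟩, hxi⟩) (fun h => hxK ((hK'R x hxR).2 h)) (y := ⟨⟨y, hyR⟩, hyi⟩)
          (fun h => hyK ((hK'R y hyR).2 h)) fun e => hxy (by simpa using e)
  · obtain ⟨g⟩ := induce_induce_iso (G := G) (hsucc p)
    exact hcore.of_iso g
  · intro u v huv
    have hv : v ∈ R := by
      by_contra hv
      rw [hzero v hv] at huv
      omega
    by_cases hu : u ∈ R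
    · rw [hpos u hu, hpos v hv] at huv
      rw [hK'R u hu, ← hadj ⟨u, hu⟩ ⟨v, hv⟩ (by omega)]
      rfl
    · rw [hK'T u hu]
      have hv' := (hR v).1 hv
      constructor
      · intro h
        by_contra huA
        exact hv'.1 (hBadj u (((hT u).1 ((hRT u).1 hu)).resolve_left huA) v h)
      · exact fun h => hAadj u h v hv'.2 fun e => hv'.1 (e ▸ h)

theorem ForcesSC.isLayered {G : SimpleGraph V} (hG : ForcesSC G) : IsLayered G := by
  induction hn : Fintype.card V using Nat.strong_induction_on generalizing V with
  | _ n ih =>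
  by_cases hreg : ∀ v w, deg G v = deg G w
  -- With no blocks, level 0 is the core.
  · refine ⟨0, fun _ => 0, ∅, by simp, by simp, ?_, by simp⟩
    refine (hG.isCore_of_regular hreg).of_iso ⟨⟨fun v => v.1, fun v => ⟨v, by simp⟩, ?_, ?_⟩, ?_⟩
    · exact fun _ => rfl
    · exact fun _ => rfl
    · exact Iff.rfl
  push Not at hreg
  obtain ⟨A, B, m, hm0, hAB, hA, hB, hBadj, hAadj, hBm, hAm, hsw⟩ := hG.exists_extremal hreg
  have hm := extremal_card_le hAB hA hB hBm hAm hsw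
  have hblock : IsBlock (G.induce {v | v ∈ A ∨ v ∈ B}) :=
    isBlock_extremal hm0 hm hAB hA hB
      (fun v hv w hw hwv => hAadj v hv w (disjoint_left.1 hAB hw) hwv)
      (fun v hv w hw h => disjoint_left.1 hAB (hBadj v hv w h) hw) hBm hAm fun v => Iff.rfl
  obtain ⟨R, hR⟩ : ∃ R : Set V, ∀ v, v ∈ R ↔ v ∉ A ∧ v ∉ B :=
    ⟨{v | v ∉ A ∧ v ∉ B}, fun v => Iff.rfl⟩
  obtain ⟨a, ha⟩ : A.Nonempty := card_pos.1 (by omega)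
  refine IsLayered.cons hR (fun v => Iff.rfl) hAB hblock hBadj hAadj
    (ih _ ?_ (ForcesSC.induce hR hsw) rfl)
  rw [← hn]
  exact Fintype.card_subtype_lt (x := a) (by simp [hR, ha])

end ForciblySC

theorem theorem1 (d : List ℕ) (hd : ForciblySC.IsDegreeSequence.{u} d) :
    ForciblySC.IsForciblySelfComplementary.{u} d ↔
      ∀ (V : Type u) [Fintype V] (G : SimpleGraph V) [DecidableRel G.Adj],
        ForciblySC.degreeSequence G = d → ForciblySC.IsElementarySCPseudoSplit G :=
  ⟨fun h _ _ _ _ hG => (h.forcesSC hG).isLayered.isElementary,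
    fun h V _ G _ hG => (h V G hG).isSelfComplementary⟩
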